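/- Let $a_1,a_2,a_3\in\mathbb R$, let $J\subseteq\mathbb R$ be open, and let $\beta:J\to(0,\infty)$ be smooth. Equip $N=\mathbb R^2\times J$ with the Riemannian metric $h=\beta(z)^{-2}(dx^2+dy^2+dz^2)$. Let $U\subseteq\mathbb R^2$ be a nonempty connected open set such that $a_1x+a_2y+a_3\in J$ for all $(x,y)\in U$ (for instance $U=\mathbb R^2$, $J=\mathbb R$), let $\varphi:U\to N$, $\varphi(x,y)=(x,y,a_1x+a_2y+a_3)$, and let $f:U\to(0,\infty)$ be smooth. For a smooth map $\varphi:(M,g)\to(N,h)$ of Riemannian manifolds let $\tau(\varphi)=\operatorname{Trace}_g\nabla d\varphi$ be the tension field and $$\tau_2(\varphi)=\operatorname{Trace}_g(\nabla^\varphi\nabla^\varphi-\nabla^\varphi_{\nabla^M})\tau(\varphi)-\operatorname{Trace}_gR^N(d\varphi,\tau(\varphi))d\varphi,\qquad R^N(X,Y)=[\nabla^N_X,\nabla^N_Y]-\nabla^N_{[X,Y]}.$$ The map is harmonic if $\tau(\varphi)\equiv0$, biharmonic if $\tau_2(\varphi)\equiv0$, and proper biharmonic if it is biharmonic but not harmonic.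 Then the map $\varphi:(U,f^{-1}\varphi^*h)\to(N,h)$ is proper biharmonic if and only if $\beta$ is nonconstant on $J$, $$\beta\beta''-2(\beta')^2=0\quad\text{at } z=a_1x+a_2y+a_3 \text{ for all } (x,y)\in U,$$ and there is a constant $c>0$ such that, for all $(x,y)\in U$ and $z=a_1x+a_2y+a_3$, one has $\beta'(z)\neq0$ and $$f(x,y)=\frac{c\sqrt{1+a_1^2+a_2^2}}{|\beta'(z)|}.$$ Moreover, $\varphi:(U,f^{-1}\varphi^*h)\to(N,h)$ is a conformal immersion with conformal factor $\lambda=f^{1/2}$, that is, $\varphi^*h=\lambda^2\,(f^{-1}\varphi^*h)$. With respect to the unit normal field $\xi=\beta(z)\,(-a_1,-a_2,1)/\sqrt{1+a_1^2+a_2^2}$, the surface $(U,\varphi^*h)$ has mean curvature $$H=\frac{\beta'(z)}{\sqrt{1+a_1^2+a_2^2}},\qquad z=a_1x+a_2y+a_3,$$ that is, its mean curvature vector field $\tfrac12\operatorname{Trace}_{\varphi^*h}\nabla d\varphi$ equals $H\xi$. -/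

import Mathlib

open scoped ContDiff

noncomputable section

namespace CoordGeom

/-- The partial derivative `∂ᵢ F` at `x`. -/
def pd {m : ℕ} (i : Fin m) (F : (Fin m → ℝ) → ℝ) (x : Fin m → ℝ) : ℝ :=
  fderiv ℝ F x (Pi.single i 1)

/-- A metric in the standard coordinates of (an open subset of) `ℝᵐ`: at each point `x` its
coefficient matrix `g x i j = g(∂ᵢ, ∂ⱼ)`. -/
abbrev Metric (m : ℕ) : Type := (Fin m → ℝ) → Matrix (Fin m) (Fin m) ℝ

/-- The scalar product `⟨X, Y⟩` of two tangent vectors at `x`. -/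
def Metric.ip {m : ℕ} (g : Metric m) (x X Y : Fin m → ℝ) : ℝ :=
  ∑ i, ∑ j, g x i j * X i * Y j

/-- The Christoffel symbol `Γᵏᵢⱼ` of the Levi-Civita connection of `g`. -/
def Metric.christoffel {m : ℕ} (g : Metric m) (k i j : Fin m) (x : Fin m → ℝ) : ℝ :=
  (1 / 2 : ℝ) * ∑ l, (g x)⁻¹ k l *
    (pd i (fun y => g y j l) x + pd j (fun y => g y i l) x - pd l (fun y => g y i j) x)

/-- The component `Rᵃ_{bcd}` of the curvature tensor, `R(∂_c, ∂_d) ∂_b = ∑ₐ Rᵃ_{bcd} ∂ₐ`, where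
`R(X, Y) Z = ∇_X ∇_Y Z - ∇_Y ∇_X Z - ∇_{[X, Y]} Z`. -/
def Metric.curvatureCoeff {m : ℕ} (g : Metric m) (a b c d : Fin m) (x : Fin m → ℝ) : ℝ :=
  pd c (g.christoffel a d b) x - pd d (g.christoffel a c b) x
    + ∑ e, (g.christoffel a c e x * g.christoffel e d b x
      - g.christoffel a d e x * g.christoffel e c b x)

/-- The curvature operator `R(X, Y) Z` at `x`. -/
def Metric.curvature {m : ℕ} (g : Metric m) (x X Y Z : Fin m → ℝ) : Fin m → ℝ :=
  fun a => ∑ b, ∑ c, ∑ d, g.curvatureCoeff a b c d x * Z b * X c * Y d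

/-- The vector field `dφ(∂ᵢ)` along `φ`. -/
def dmap {m n : ℕ} (φ : (Fin m → ℝ) → (Fin n → ℝ)) (i : Fin m) (x : Fin m → ℝ) : Fin n → ℝ :=
  fun a => pd i (fun y => φ y a) x

/-- The pull-back metric `φ* h`. -/
def pullback {m n : ℕ} (h : Metric n) (φ : (Fin m → ℝ) → (Fin n → ℝ)) : Metric m :=
  fun x => Matrix.of fun i j => h.ip (φ x) (dmap φ i x) (dmap φ j x)

/-- The pull-back connection `∇^φ_{∂ᵢ} V` applied to a vector field `V` along `φ`. -/
def pullbackConn {m n : ℕ} (h : Metric n) (φ : (Fin m → ℝ) → (Fin n → ℝ)) (i : Fin m)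
    (V : (Fin m → ℝ) → (Fin n → ℝ)) (x : Fin m → ℝ) : Fin n → ℝ :=
  fun a => pd i (fun y => V y a) x
    + ∑ b, ∑ c, h.christoffel a b c (φ x) * dmap φ i x b * V x c

/-- The tension field `τ(φ) = Trace_g ∇dφ` of `φ : (U, g) → (N, h)`, where
`∇dφ(∂ᵢ, ∂ⱼ) = ∇^φ_{∂ᵢ} dφ(∂ⱼ) - dφ(∇_{∂ᵢ} ∂ⱼ)`. -/
def tension {m n : ℕ} (g : Metric m) (h : Metric n) (φ : (Fin m → ℝ) → (Fin n → ℝ))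
    (x : Fin m → ℝ) : Fin n → ℝ :=
  ∑ i, ∑ j, (g x)⁻¹ i j •
    (pullbackConn h φ i (dmap φ j) x - ∑ k, g.christoffel k i j x • dmap φ k x)

/-- The bitension field
`τ₂(φ) = Trace_g (∇^φ ∇^φ - ∇^φ_{∇}) τ(φ) - Trace_g R^N(dφ, τ(φ)) dφ`. -/
def bitension {m n : ℕ} (g : Metric m) (h : Metric n) (φ : (Fin m → ℝ) → (Fin n → ℝ))
    (x : Fin m → ℝ) : Fin n → ℝ :=
  (∑ i, ∑ j, (g x)⁻¹ i j •
    (pullbackConn h φ i (pullbackConn h φ j (tension g h φ)) x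
      - ∑ k, g.christoffel k i j x • pullbackConn h φ k (tension g h φ) x))
  - ∑ i, ∑ j, (g x)⁻¹ i j • h.curvature (φ x) (dmap φ i x) (tension g h φ x) (dmap φ j x)

/-- The (smooth) map `φ : (U, g) → (N, h)` is harmonic: `τ(φ) = 0`. -/
def IsHarmonicOn {m n : ℕ} (g : Metric m) (h : Metric n) (φ : (Fin m → ℝ) → (Fin n → ℝ))
    (U : Set (Fin m → ℝ)) : Prop :=
  ∀ x ∈ U, tension g h φ x = 0

/-- The (smooth) map `φ : (U, g) → (N, h)` is biharmonic: `τ₂(φ) = 0`. -/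
def IsBiharmonicOn {m n : ℕ} (g : Metric m) (h : Metric n) (φ : (Fin m → ℝ) → (Fin n → ℝ))
    (U : Set (Fin m → ℝ)) : Prop :=
  ∀ x ∈ U, bitension g h φ x = 0

/-- Proper biharmonic: biharmonic and not harmonic. -/
def IsProperBiharmonicOn {m n : ℕ} (g : Metric m) (h : Metric n)
    (φ : (Fin m → ℝ) → (Fin n → ℝ)) (U : Set (Fin m → ℝ)) : Prop :=
  IsBiharmonicOn g h φ U ∧ ¬ IsHarmonicOn g h φ U

/-- `φ : (U, g) → (N, h)` is a conformal immersion with conformal factor `lam > 0`: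
`φ* h = lam² g` on `U`. -/
def HasConformalFactorOn {m n : ℕ} (g : Metric m) (h : Metric n)
    (φ : (Fin m → ℝ) → (Fin n → ℝ)) (lam : (Fin m → ℝ) → ℝ) (U : Set (Fin m → ℝ)) : Prop :=
  ∀ x ∈ U, 0 < lam x ∧ pullback h φ x = lam x ^ 2 • g x

/-- `ξ` is a field of unit normal vectors along the hypersurface `φ : U → (N, h)`. -/
def IsUnitNormalOn {m n : ℕ} (h : Metric n) (φ ξ : (Fin m → ℝ) → (Fin n → ℝ))
    (U : Set (Fin m → ℝ)) : Prop :=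
  ∀ x ∈ U, h.ip (φ x) (ξ x) (ξ x) = 1 ∧ ∀ i, h.ip (φ x) (ξ x) (dmap φ i x) = 0

/-- The mean curvature vector field `η = (1/m) Trace_g ∇dφ`, `g = φ* h`, of the isometric immersion
`φ : (U, φ* h) → (N, h)`. -/
def meanCurvatureVector {m n : ℕ} (h : Metric n) (φ : (Fin m → ℝ) → (Fin n → ℝ))
    (x : Fin m → ℝ) : Fin n → ℝ :=
  (1 / (m : ℝ)) • tension (pullback h φ) h φ x

/-- `H` is the mean curvature of `φ : (U, φ* h) → (N, h)` with respect to the unit normal field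
`ξ`, that is, `η = H ξ`. -/
def HasMeanCurvatureOn {m n : ℕ} (h : Metric n) (φ ξ : (Fin m → ℝ) → (Fin n → ℝ))
    (H : (Fin m → ℝ) → ℝ) (U : Set (Fin m → ℝ)) : Prop :=
  IsUnitNormalOn h φ ξ U ∧ ∀ x ∈ U, meanCurvatureVector h φ x = H x • ξ x

/-- The metric `β(z)⁻² (dx² + dy² + dz²)` in dimension three. -/
def confMetric (β : ℝ → ℝ) : Metric 3 :=
  fun q => (β (q 2) ^ 2)⁻¹ • (1 : Matrix (Fin 3) (Fin 3) ℝ)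

/-- The height `z = a₁ x + a₂ y + a₃` of the plane over the point `(x, y)`. -/
def planeHeight (a₁ a₂ a₃ : ℝ) (p : Fin 2 → ℝ) : ℝ := a₁ * p 0 + a₂ * p 1 + a₃

/-- The parametrization `(x, y) ↦ (x, y, a₁ x + a₂ y + a₃)` of the plane. -/
def planeMap (a₁ a₂ a₃ : ℝ) (p : Fin 2 → ℝ) : Fin 3 → ℝ := ![p 0, p 1, planeHeight a₁ a₂ a₃ p]

/-- The upward unit normal `β(z) (-a₁, -a₂, 1) / √(1 + a₁² + a₂²)` of the plane with respect to
`confMetric β`. -/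
def planeNormal (β : ℝ → ℝ) (a₁ a₂ a₃ : ℝ) (p : Fin 2 → ℝ) : Fin 3 → ℝ :=
  (β (planeHeight a₁ a₂ a₃ p) / √(1 + a₁ ^ 2 + a₂ ^ 2)) • ![-a₁, -a₂, 1]

/-- The metric `f⁻¹ φ* h` on the plane, where `h = confMetric β` and `φ` is `planeMap`. -/
def planeMetric (β : ℝ → ℝ) (a₁ a₂ a₃ : ℝ) (f : (Fin 2 → ℝ) → ℝ) : Metric 2 :=
  fun p => (f p)⁻¹ • pullback (confMetric β) (planeMap a₁ a₂ a₃) p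

end CoordGeom

end

/-!
The induced metric on a plane in a conformally flat space is conformal to a constant metric, so in
dimension two its coordinates are harmonic and the traces defining `τ` and `τ₂` lose their domain
Christoffel symbols. With `N = b⁻² (dx² + dy² + dz²)` and `ν` the Euclidean normal of the plane,
`τ = b P ν` where `P = 2 f ∂_ν b / |ν|²`. The part of `τ₂` tangent to the plane is a nonvanishing
multiple of `P grad P`, so a biharmonic plane in a connected chart has `|P|` constant. Then `P` is
locally constant, its second derivatives drop out of the normal part of `τ₂`, and what remains is
`P` times an expression in the 2-jet of `b` along the plane. For `b = β(z)` that expression is a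
positive multiple of `β β'' - 2 β'²`, and constancy of `|P|` is the formula for `f`.
-/

noncomputable section

open Matrix Topology

namespace CoordGeom

section PartialDerivatives

variable {m n : ℕ} {i : Fin m} {F G : (Fin m → ℝ) → ℝ} {x : Fin m → ℝ}

/-- The Euclidean coordinate gradient `(∂₁F, …, ∂ₘF)`. -/
def grad (F : (Fin m → ℝ) → ℝ) (x : Fin m → ℝ) : Fin m → ℝ := fun i => pd i F x

/-- The Euclidean coordinate Hessian `∂ᵢ∂ⱼF`. -/
def hess (F : (Fin m → ℝ) → ℝ) (x : Fin m → ℝ) : Matrix (Fin m) (Fin m) ℝ :=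
  Matrix.of fun i j => pd i (pd j F) x

lemma pd_congr (hFG : F =ᶠ[𝓝 x] G) : pd i F x = pd i G x := by
  rw [pd, pd, hFG.fderiv_eq]

@[simp] lemma pd_const (c : ℝ) : pd i (fun _ => c) x = 0 := by
  simp [pd]

lemma pd_mul (hF : DifferentiableAt ℝ F x) (hG : DifferentiableAt ℝ G x) :
    pd i (fun y => F y * G y) x = pd i F x * G x + F x * pd i G x := by
  simp [pd, fderiv_fun_mul hF hG, mul_comm, add_comm]

lemma pd_mul_const (hF : DifferentiableAt ℝ F x) (c : ℝ) :
    pd i (fun y => F y * c) x = pd i F x * c := by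
  simp [pd_mul hF (differentiableAt_const c)]

lemma fderiv_apply_eq_grad_dotProduct (v : Fin m → ℝ) :
    fderiv ℝ F x v = grad F x ⬝ᵥ v := by
  conv_lhs => rw [pi_eq_sum_univ' v]
  simp [dotProduct, grad, pd, mul_comm]

lemma dmap_eq_fderiv {φ : (Fin m → ℝ) → (Fin n → ℝ)} (hφ : DifferentiableAt ℝ φ x) :
    dmap φ i x = fderiv ℝ φ x (Pi.single i 1) := by
  ext a
  simp [dmap, pd, fderiv_apply hφ a]

lemma pd_comp {φ : (Fin m → ℝ) → (Fin n → ℝ)} {F : (Fin n → ℝ) → ℝ}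
    (hF : DifferentiableAt ℝ F (φ x)) (hφ : DifferentiableAt ℝ φ x) :
    pd i (fun y => F (φ y)) x = grad F (φ x) ⬝ᵥ dmap φ i x := by
  rw [pd, fderiv_fun_comp x hF hφ, ContinuousLinearMap.comp_apply,
    ← dmap_eq_fderiv hφ, fderiv_apply_eq_grad_dotProduct]

lemma contDiffAt_pd {k : WithTop ℕ∞} (hF : ContDiffAt ℝ (k + 1) F x) (i : Fin m) :
    ContDiffAt ℝ k (pd i F) x :=
  (hF.fderiv_right le_rfl).clm_apply contDiffAt_const

lemma contDiffAt_grad_dotProduct {k : WithTop ℕ∞} (hF : ContDiffAt ℝ (k + 1) F x)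
    (v : Fin m → ℝ) : ContDiffAt ℝ k (fun y => grad F y ⬝ᵥ v) x :=
  ContDiffAt.sum fun i _ => (contDiffAt_pd hF i).mul contDiffAt_const

lemma isSymm_hess (hF : ContDiffAt ℝ 2 F x) : (hess F x).IsSymm := by
  have hF' : DifferentiableAt ℝ (fderiv ℝ F) x :=
    (hF.fderiv_right (m := 1) (by norm_num)).differentiableAt (by simp)
  have hpd (i j : Fin m) :
      pd i (pd j F) x = fderiv ℝ (fderiv ℝ F) x (Pi.single i 1) (Pi.single j 1) := by
    change fderiv ℝ (fun y => fderiv ℝ F y (Pi.single j 1)) x (Pi.single i 1) = _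
    simp [fderiv_clm_apply hF' (differentiableAt_const _)]
  ext i j
  simpa [hess, hpd] using (hF.isSymmSndFDerivAt (by simp)).eq (Pi.single j 1) (Pi.single i 1)

lemma dotProduct_hess_mulVec_comm (hF : ContDiffAt ℝ 2 F x) (v w : Fin m → ℝ) :
    v ⬝ᵥ hess F x *ᵥ w = w ⬝ᵥ hess F x *ᵥ v := by
  rw [dotProduct_mulVec, ← mulVec_transpose, isSymm_hess hF, dotProduct_comm]

lemma grad_grad_dotProduct (hF : ContDiffAt ℝ 2 F x) (v : Fin m → ℝ) :
    grad (fun y => grad F y ⬝ᵥ v) x = hess F x *ᵥ v := by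
  have hpd (j : Fin m) : DifferentiableAt ℝ (pd j F) x :=
    (contDiffAt_pd (k := 1) (by simpa [one_add_one_eq_two] using hF) j).differentiableAt (by simp)
  ext i
  have hsum : pd i (fun y => ∑ j, pd j F y * v j) x = ∑ j, pd i (fun y => pd j F y * v j) x := by
    conv_lhs => rw [pd, fderiv_fun_sum fun j _ => (hpd j).mul_const (v j)]
    simp only [FunLike.coe_sum, Finset.sum_apply, pd]
  simp [grad, dotProduct, mulVec, hess, hsum, pd_mul_const (hpd _)]

lemma hess_eq_zero_of_grad_eventually_eq_zero (hF : ∀ᶠ y in 𝓝 x, grad F y = 0) :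
    hess F x = 0 := by
  ext i j
  have hj : pd j F =ᶠ[𝓝 x] fun _ => 0 := hF.mono fun y hy => congrFun hy j
  exact (pd_congr hj).trans (pd_const 0)

lemma grad_comp_apply {γ : ℝ → ℝ} {k : Fin m} (hγ : DifferentiableAt ℝ γ (x k)) :
    grad (fun y => γ (y k)) x = Pi.single k (deriv γ (x k)) := by
  have hcomp := hγ.hasDerivAt.comp_hasFDerivAt (h₂ := γ) x (hasFDerivAt_apply (𝕜 := ℝ) k x)
  ext i
  change fderiv ℝ (γ ∘ fun y => y k) x (Pi.single i 1) = _
  simp [hcomp.fderiv, Pi.single_apply, eq_comm]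

lemma hess_comp_apply {γ : ℝ → ℝ} {k : Fin m} (hγ : ContDiffAt ℝ 2 γ (x k)) :
    hess (fun y => γ (y k)) x = Matrix.single k k (deriv (deriv γ) (x k)) := by
  have hγ' : ∀ᶠ y in 𝓝 x, DifferentiableAt ℝ γ (y k) :=
    (continuous_apply k).continuousAt.eventually
      ((hγ.eventually (by simp)).mono fun z hz => hz.differentiableAt (by simp))
  have hdγ : DifferentiableAt ℝ (deriv γ) (x k) :=
    (hγ.derivWithin (m := 1) (by norm_num)).differentiableAt (by simp)
  ext i j
  have hgrad : pd j (fun y => γ (y k)) =ᶠ[𝓝 x] fun y => deriv γ (y k) * if j = k then 1 else 0 :=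
    hγ'.mono fun y hy => by
      simpa [grad, Pi.single_apply] using congrFun (grad_comp_apply hy) j
  have hi := congrFun (grad_comp_apply (x := x) (hdγ.mul_const (if j = k then 1 else 0))) i
  rw [grad] at hi
  rw [hess, Matrix.of_apply, pd_congr hgrad, hi, deriv_mul_const hdγ]
  simp only [Matrix.single_apply, Pi.single_apply]
  grind

lemma fderiv_eq_zero_iff_grad_eq_zero : fderiv ℝ F x = 0 ↔ grad F x = 0 := by
  simp [ContinuousLinearMap.ext_iff, fderiv_apply_eq_grad_dotProduct, dotProduct_eq_zero_iff]

lemma grad_mul_self (hF : DifferentiableAt ℝ F x) :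
    grad (fun y => F y * F y) x = (2 : ℝ) • F x • grad F x := by
  ext i
  simp only [grad, pd_mul hF hF, Pi.smul_apply, smul_eq_mul]
  ring

lemma exists_abs_eq_of_smul_grad_eq_zero {U : Set (Fin m → ℝ)} (hU : IsOpen U)
    (hUc : IsPreconnected U) (hF : DifferentiableOn ℝ F U)
    (hgrad : ∀ y ∈ U, F y • grad F y = 0) : ∃ c, ∀ y ∈ U, |F y| = c := by
  obtain ⟨k, hk⟩ := hU.exists_is_const_of_fderiv_eq_zero (𝕜 := ℝ) hUc (hF.fun_mul hF)
    fun y hy => by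
      rw [Pi.zero_apply, fderiv_eq_zero_iff_grad_eq_zero,
        grad_mul_self (hF.differentiableAt (hU.mem_nhds hy)), hgrad y hy, smul_zero]
  exact ⟨√k, fun y hy => by rw [← hk y hy, Real.sqrt_mul_self_eq_abs]⟩

lemma smul_grad_eq_zero_of_abs_eventually_eq {c : ℝ} (hF : DifferentiableAt ℝ F x)
    (hc : ∀ᶠ y in 𝓝 x, |F y| = c) : F x • grad F x = 0 := by
  have hconst : (fun y => F y * F y) =ᶠ[𝓝 x] fun _ => c * c :=
    hc.mono fun y hy => by simp only [← hy, abs_mul_abs_self]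
  have hzero : grad (fun y => F y * F y) x = 0 := by
    ext i
    exact (pd_congr hconst).trans (pd_const _)
  simpa [grad_mul_self hF] using hzero

end PartialDerivatives

section Trace

variable {m n : ℕ} {g : Metric m} (h : Metric n) {φ : (Fin m → ℝ) → (Fin n → ℝ)} {x : Fin m → ℝ}

/-- The standard coordinates are harmonic for `g` at `x`: `∑ᵢⱼ gⁱʲ Γᵏᵢⱼ = 0` for all `k`. In such
coordinates the traces of second covariant derivatives carry no Christoffel symbols of `g`. -/
def Metric.HasHarmonicCoordsAt (g : Metric m) (x : Fin m → ℝ) : Prop :=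
  ∀ k, ∑ i, ∑ j, (g x)⁻¹ i j * g.christoffel k i j x = 0

lemma sum_inv_mul_metric_contraction {S : Matrix (Fin m) (Fin m) ℝ} (hS : S.IsSymm)
    (hdet : IsUnit S.det) (v : Fin m → ℝ) (l : Fin m) :
    ∑ i, ∑ j, S⁻¹ i j * (v i * S j l + v j * S i l - v l * S i j) = (2 - m) * v l := by
  have hinv (i k) : ∑ j, S⁻¹ i j * S j k = (1 : Matrix (Fin m) (Fin m) ℝ) i k := by
    rw [← Matrix.nonsing_inv_mul S hdet, Matrix.mul_apply]
  have hinv' (j k) : ∑ i, S⁻¹ i j * S i k = (1 : Matrix (Fin m) (Fin m) ℝ) j k := by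
    simpa only [hS.inv.apply] using hinv j k
  have hdiag (i) : ∑ j, S⁻¹ i j * S i j = 1 := by
    simpa only [hS.apply i, Matrix.one_apply_eq] using hinv i i
  have h₁ : ∑ i, ∑ j, S⁻¹ i j * (v i * S j l) = v l := by
    simp [mul_left_comm _ (v _), ← Finset.mul_sum, hinv, Matrix.one_apply]
  have h₂ : ∑ i, ∑ j, S⁻¹ i j * (v j * S i l) = v l := by
    rw [Finset.sum_comm]
    simp [mul_left_comm _ (v _), ← Finset.mul_sum, hinv', Matrix.one_apply]
  have h₃ : ∑ i, ∑ j, S⁻¹ i j * (v l * S i j) = m * v l := by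
    simp [mul_comm (v l), ← mul_assoc, ← Finset.sum_mul, hdiag]
  simp only [mul_add, mul_sub, Finset.sum_add_distrib, Finset.sum_sub_distrib, h₁, h₂, h₃]
  ring

lemma sum_inv_mul_christoffel_of_eq_smul {G : (Fin m → ℝ) → ℝ} {S : Matrix (Fin m) (Fin m) ℝ}
    (hg : ∀ y, g y = G y • S) (hG : DifferentiableAt ℝ G x) (hGx : G x ≠ 0) (hS : S.IsSymm)
    (hdet : IsUnit S.det) (k : Fin m) :
    ∑ i, ∑ j, (g x)⁻¹ i j * g.christoffel k i j x =
      (2 - m) / (2 * G x ^ 2) * (S⁻¹ *ᵥ grad G x) k := by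
  have hpd (i j l) : pd i (fun y => g y j l) x = grad G x i * S j l := by
    simp only [hg, Matrix.smul_apply, smul_eq_mul, pd_mul_const hG, grad]
  have hinv : (g x)⁻¹ = (G x)⁻¹ • S⁻¹ := Matrix.inv_eq_right_inv <| by
    rw [hg, smul_mul_smul_comm, mul_inv_cancel₀ hGx, Matrix.mul_nonsing_inv S hdet, one_smul]
  calc ∑ i, ∑ j, (g x)⁻¹ i j * g.christoffel k i j x
      = ∑ i, ∑ j, ∑ l, (2 * G x ^ 2)⁻¹ * (S⁻¹ k l * (S⁻¹ i j *
          (grad G x i * S j l + grad G x j * S i l - grad G x l * S i j))) := by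
        simp only [Metric.christoffel, hinv, hpd, Matrix.smul_apply, smul_eq_mul, Finset.mul_sum]
        refine Finset.sum_congr rfl fun i _ => Finset.sum_congr rfl fun j _ =>
          Finset.sum_congr rfl fun l _ => ?_
        field_simp
    _ = (2 * G x ^ 2)⁻¹ * ∑ l, S⁻¹ k l * ∑ i, ∑ j, S⁻¹ i j *
          (grad G x i * S j l + grad G x j * S i l - grad G x l * S i j) := by
        simp only [Finset.mul_sum]
        exact (Finset.sum_congr rfl fun i _ => Finset.sum_comm).trans Finset.sum_comm
    _ = (2 - m) / (2 * G x ^ 2) * (S⁻¹ *ᵥ grad G x) k := by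
        simp only [sum_inv_mul_metric_contraction hS hdet, mul_left_comm _ (2 - (m : ℝ)),
          ← Finset.mul_sum, mulVec, dotProduct]
        ring

lemma hasHarmonicCoordsAt_of_eq_smul {g : Metric 2} {G : (Fin 2 → ℝ) → ℝ} {x : Fin 2 → ℝ}
    {S : Matrix (Fin 2) (Fin 2) ℝ} (hg : ∀ y, g y = G y • S) (hG : DifferentiableAt ℝ G x)
    (hGx : G x ≠ 0) (hS : S.IsSymm) (hdet : IsUnit S.det) : g.HasHarmonicCoordsAt x := fun k =>
  (sum_inv_mul_christoffel_of_eq_smul hg hG hGx hS hdet k).trans (by norm_num)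

lemma Metric.HasHarmonicCoordsAt.sum_inv_smul_sub (hg : g.HasHarmonicCoordsAt x)
    (A : Fin m → Fin m → Fin n → ℝ) (V : Fin m → Fin n → ℝ) :
    ∑ i, ∑ j, (g x)⁻¹ i j • (A i j - ∑ k, g.christoffel k i j x • V k) =
      ∑ i, ∑ j, (g x)⁻¹ i j • A i j := by
  have hV : ∑ i, ∑ j, ∑ k, ((g x)⁻¹ i j * g.christoffel k i j x) • V k = 0 := calc
    _ = ∑ k, (∑ i, ∑ j, (g x)⁻¹ i j * g.christoffel k i j x) • V k := by
      simp only [Finset.sum_smul]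
      exact (Finset.sum_congr rfl fun i _ => Finset.sum_comm).trans Finset.sum_comm
    _ = 0 := by simp only [hg _, zero_smul, Finset.sum_const_zero]
  simp only [smul_sub, Finset.sum_sub_distrib, Finset.smul_sum, smul_smul, hV, sub_zero]

lemma tension_of_hasHarmonicCoordsAt (hg : g.HasHarmonicCoordsAt x) :
    tension g h φ x = ∑ i, ∑ j, (g x)⁻¹ i j • pullbackConn h φ i (dmap φ j) x :=
  hg.sum_inv_smul_sub _ _

lemma bitension_of_hasHarmonicCoordsAt (hg : g.HasHarmonicCoordsAt x) :
    bitension g h φ x =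
      ∑ i, ∑ j, (g x)⁻¹ i j • pullbackConn h φ i (pullbackConn h φ j (tension g h φ)) x -
        ∑ i, ∑ j, (g x)⁻¹ i j •
          h.curvature (φ x) (dmap φ i x) (tension g h φ x) (dmap φ j x) := by
  rw [bitension, hg.sum_inv_smul_sub]

lemma pullbackConn_congr {V W : (Fin m → ℝ) → (Fin n → ℝ)} {i : Fin m} (hVW : V =ᶠ[𝓝 x] W) :
    pullbackConn h φ i V x = pullbackConn h φ i W x := by
  ext a
  rw [pullbackConn, pullbackConn, pd_congr (hVW.mono fun y hy => by rw [hy]), hVW.self_of_nhds]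

end Trace

section Curvature

variable {m : ℕ} {g : Metric m} {x : Fin m → ℝ}

/-- The connection form `Γ(X, Y) = ∑ Γᵃᵢⱼ Xⁱ Yʲ ∂ₐ`, so that `∇_X Y = D_X Y + Γ(X, Y)`. -/
def Metric.connForm (g : Metric m) (x X Y : Fin m → ℝ) : Fin m → ℝ :=
  fun a => ∑ i, ∑ j, g.christoffel a i j x * X i * Y j

lemma Metric.connForm_sub (X Y Z : Fin m → ℝ) :
    g.connForm x X (Y - Z) = g.connForm x X Y - g.connForm x X Z := by
  ext a
  simp only [Metric.connForm, Pi.sub_apply, mul_sub, Finset.sum_sub_distrib]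

lemma Metric.connForm_smul (c : ℝ) (X Y : Fin m → ℝ) :
    g.connForm x X (c • Y) = c • g.connForm x X Y := by
  ext a
  simp only [Metric.connForm, Pi.smul_apply, smul_eq_mul, Finset.mul_sum, mul_left_comm c]

lemma pullbackConn_eq_add_connForm {n : ℕ} (h : Metric n) (φ : (Fin m → ℝ) → (Fin n → ℝ))
    (i : Fin m) (V : (Fin m → ℝ) → (Fin n → ℝ)) :
    pullbackConn h φ i V x = dmap V i x + h.connForm (φ x) (dmap φ i x) (V x) :=
  rfl

lemma Metric.curvature_smul (t : ℝ) (X Y Z : Fin m → ℝ) :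
    g.curvature x X (t • Y) Z = t • g.curvature x X Y Z := by
  ext a
  simp only [Metric.curvature, Pi.smul_apply, smul_eq_mul, Finset.mul_sum, mul_left_comm t]

lemma grad_connForm_dotProduct
    (hΓ : ∀ a i j, DifferentiableAt ℝ (g.christoffel a i j) x) (X Y Z : Fin m → ℝ) (a : Fin m) :
    grad (fun y => g.connForm y Y Z a) x ⬝ᵥ X =
      ∑ c, ∑ d, ∑ b, pd c (g.christoffel a d b) x * Y d * Z b * X c := by
  have hdiff (d b) : DifferentiableAt ℝ (fun y => g.christoffel a d b y * Y d * Z b) x :=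
    ((hΓ a d b).mul_const _).mul_const _
  refine Finset.sum_congr rfl fun c _ => ?_
  rw [grad, pd]
  simp only [Metric.connForm]
  rw [fderiv_fun_sum fun d _ => .fun_sum fun b _ => hdiff d b]
  simp only [fderiv_fun_sum fun b _ => hdiff _ b, FunLike.coe_sum, Finset.sum_apply,
    Finset.sum_mul]
  change ∑ d, ∑ b, pd c (fun y => g.christoffel a d b y * Y d * Z b) x * X c = _
  simp only [pd_mul_const ((hΓ _ _ _).mul_const _), pd_mul_const (hΓ _ _ _)]

lemma Metric.curvature_apply_eq_connForm
    (hΓ : ∀ a i j, DifferentiableAt ℝ (g.christoffel a i j) x) (X Y Z : Fin m → ℝ) (a : Fin m) :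
    g.curvature x X Y Z a =
      grad (fun y => g.connForm y Y Z a) x ⬝ᵥ X - grad (fun y => g.connForm y X Z a) x ⬝ᵥ Y +
        (g.connForm x X (g.connForm x Y Z) a - g.connForm x Y (g.connForm x X Z) a) := by
  have hcurv : g.curvature x X Y Z a =
      ∑ c, ∑ d, ∑ b, g.curvatureCoeff a b c d x * Z b * X c * Y d :=
    Finset.sum_comm.trans (Finset.sum_congr rfl fun c _ => Finset.sum_comm)
  have hquad (X Y : Fin m → ℝ) : g.connForm x X (g.connForm x Y Z) a =
      ∑ c, ∑ d, ∑ b, ∑ e,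
        g.christoffel a c e x * X c * (g.christoffel e d b x * Y d * Z b) := by
    simp only [Metric.connForm, Finset.mul_sum]
    exact Finset.sum_congr rfl fun c _ =>
      Finset.sum_comm.trans (Finset.sum_congr rfl fun d _ => Finset.sum_comm)
  rw [hcurv, grad_connForm_dotProduct hΓ, grad_connForm_dotProduct hΓ, hquad X Y, hquad Y X,
    Finset.sum_comm (f := fun c d => ∑ b, pd c (g.christoffel a d b) x * X d * Z b * Y c),
    Finset.sum_comm (f := fun c d => ∑ b, ∑ e,
      g.christoffel a c e x * Y c * (g.christoffel e d b x * X d * Z b))]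
  simp only [← Finset.sum_sub_distrib, ← Finset.sum_add_distrib]
  refine Finset.sum_congr rfl fun c _ => Finset.sum_congr rfl fun d _ =>
    Finset.sum_congr rfl fun b _ => ?_
  simp only [Metric.curvatureCoeff, add_mul, Finset.sum_mul]
  congr 1
  · ring
  · exact Finset.sum_congr rfl fun e _ => by ring

end Curvature

section ConformallyFlat

variable {n : ℕ} {b : (Fin n → ℝ) → ℝ} {x : Fin n → ℝ}

/-- The conformally flat metric `b⁻² (dx₁² + ⋯ + dxₙ²)`. -/
def confFlat (b : (Fin n → ℝ) → ℝ) : Metric n :=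
  fun x => (b x ^ 2)⁻¹ • (1 : Matrix (Fin n) (Fin n) ℝ)

lemma ip_confFlat (X Y : Fin n → ℝ) : (confFlat b).ip x X Y = (b x ^ 2)⁻¹ * (X ⬝ᵥ Y) := by
  simp [Metric.ip, confFlat, Matrix.one_apply, dotProduct, Finset.mul_sum, mul_assoc]

lemma christoffel_confFlat (hb : DifferentiableAt ℝ b x) (hbx : b x ≠ 0) (k i j : Fin n) :
    (confFlat b).christoffel k i j x = -(b x)⁻¹ *
      (grad b x i * (1 : Matrix _ _ ℝ) k j + grad b x j * (1 : Matrix _ _ ℝ) k i -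
        grad b x k * (1 : Matrix _ _ ℝ) i j) := by
  have hinv : (confFlat b x)⁻¹ = b x ^ 2 • (1 : Matrix (Fin n) (Fin n) ℝ) :=
    Matrix.inv_eq_right_inv <| by
      rw [confFlat, smul_mul_smul_comm, inv_mul_cancel₀ (pow_ne_zero 2 hbx), mul_one, one_smul]
  have hsq : HasFDerivAt (fun y => (b y ^ 2)⁻¹) ((-2 / b x ^ 3) • fderiv ℝ b x) x :=
    (((hasDerivAt_pow 2 (b x)).fun_inv (pow_ne_zero 2 hbx)).comp_hasFDerivAt
      (h₂ := fun t => (t ^ 2)⁻¹) x hb.hasFDerivAt).congr_fderiv <| by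
        congr 1
        push_cast
        field_simp
  have hpd (i j l) : pd i (fun y => confFlat b y j l) x =
      -2 / b x ^ 3 * grad b x i * (1 : Matrix (Fin n) (Fin n) ℝ) j l := by
    simp only [confFlat, Matrix.smul_apply, smul_eq_mul, pd_mul_const hsq.differentiableAt]
    rw [pd, hsq.fderiv]
    rfl
  have hdelta (v : Fin n → ℝ) : ∑ l, (1 : Matrix (Fin n) (Fin n) ℝ) k l * v l = v k :=
    congrFun (one_mulVec v) k
  simp only [Metric.christoffel, hinv, hpd, Matrix.smul_apply, smul_eq_mul, mul_assoc,
    ← Finset.mul_sum, hdelta]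
  simp only [Matrix.one_apply, eq_comm (a := k)]
  field_simp
  ring

lemma connForm_confFlat (hb : DifferentiableAt ℝ b x) (hbx : b x ≠ 0) (X Y : Fin n → ℝ) :
    (confFlat b).connForm x X Y = -(b x)⁻¹ •
      ((grad b x ⬝ᵥ X) • Y + (grad b x ⬝ᵥ Y) • X - (X ⬝ᵥ Y) • grad b x) := by
  ext a
  have hterms (i j : Fin n) : (confFlat b).christoffel a i j x * X i * Y j = -(b x)⁻¹ *
      (grad b x i * X i * ((1 : Matrix (Fin n) (Fin n) ℝ) a j * Y j) +
        (1 : Matrix (Fin n) (Fin n) ℝ) a i * X i * (grad b x j * Y j) -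
        grad b x a * (X i * ((1 : Matrix (Fin n) (Fin n) ℝ) i j * Y j))) := by
    rw [christoffel_confFlat hb hbx]
    ring
  have hdelta (v : Fin n → ℝ) (k) : ∑ l, (1 : Matrix (Fin n) (Fin n) ℝ) k l * v l = v k :=
    congrFun (one_mulVec v) k
  simp only [Metric.connForm, hterms, ← Finset.mul_sum, Finset.sum_add_distrib,
    Finset.sum_sub_distrib, ← Finset.sum_mul, hdelta, Pi.smul_apply, Pi.add_apply, Pi.sub_apply,
    smul_eq_mul, dotProduct]
  ring

lemma differentiableAt_christoffel_confFlat (hb : ContDiffAt ℝ 2 b x) (hbx : b x ≠ 0)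
    (k i j : Fin n) : DifferentiableAt ℝ ((confFlat b).christoffel k i j) x := by
  have hb' : DifferentiableAt ℝ b x := hb.differentiableAt (by simp)
  have hgrad (l) : DifferentiableAt ℝ (fun y => grad b y l) x :=
    (contDiffAt_pd (k := 1) (by simpa [one_add_one_eq_two] using hb) l).differentiableAt (by simp)
  have hev : (confFlat b).christoffel k i j =ᶠ[𝓝 x] fun y => -(b y)⁻¹ *
      (grad b y i * (1 : Matrix _ _ ℝ) k j + grad b y j * (1 : Matrix _ _ ℝ) k i -
        grad b y k * (1 : Matrix _ _ ℝ) i j) := by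
    filter_upwards [hb.eventually (by simp), hb'.continuousAt.eventually_ne hbx] with y hy hby
    exact christoffel_confFlat (hy.differentiableAt (by simp)) hby k i j
  refine DifferentiableAt.congr_of_eventuallyEq ?_ hev
  exact (hb'.inv hbx).neg.mul
    ((((hgrad i).mul_const _).add ((hgrad j).mul_const _)).sub ((hgrad k).mul_const _))

lemma grad_connForm_confFlat_dotProduct (hb : ContDiffAt ℝ 2 b x) (hbx : b x ≠ 0)
    (X Y Z : Fin n → ℝ) (a : Fin n) :
    grad (fun y => (confFlat b).connForm y Y Z a) x ⬝ᵥ X =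
      (grad b x ⬝ᵥ X) / b x ^ 2 *
          ((grad b x ⬝ᵥ Y) * Z a + (grad b x ⬝ᵥ Z) * Y a - (Y ⬝ᵥ Z) * grad b x a) -
        (b x)⁻¹ * ((X ⬝ᵥ hess b x *ᵥ Y) * Z a + (X ⬝ᵥ hess b x *ᵥ Z) * Y a -
          (Y ⬝ᵥ Z) * (hess b x *ᵥ X) a) := by
  have hb' : DifferentiableAt ℝ b x := hb.differentiableAt (by simp)
  have hgrad (v : Fin n → ℝ) : HasFDerivAt (fun y => grad b y ⬝ᵥ v) _ x :=
    ((contDiffAt_grad_dotProduct (k := 1) (by simpa [one_add_one_eq_two] using hb) v)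
      |>.differentiableAt (by simp)).hasFDerivAt
  have hgrad' (v : Fin n → ℝ) : fderiv ℝ (fun y => grad b y ⬝ᵥ v) x X = X ⬝ᵥ hess b x *ᵥ v := by
    rw [fderiv_apply_eq_grad_dotProduct, grad_grad_dotProduct hb, dotProduct_comm]
  have ha : X ⬝ᵥ hess b x *ᵥ Pi.single a 1 = (hess b x *ᵥ X) a := by
    rw [dotProduct_hess_mulVec_comm hb, single_one_dotProduct]
  have hev : (fun y => (confFlat b).connForm y Y Z a) =ᶠ[𝓝 x] fun y => -(b y)⁻¹ *
      ((grad b y ⬝ᵥ Y) * Z a + (grad b y ⬝ᵥ Z) * Y a -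
        (grad b y ⬝ᵥ Pi.single a 1) * (Y ⬝ᵥ Z)) := by
    filter_upwards [hb.eventually (by simp), hb'.continuousAt.eventually_ne hbx] with y hy hby
    simp [connForm_confFlat (hy.differentiableAt (by simp)) hby, mul_comm]
  have hinv : HasFDerivAt (fun y => (b y)⁻¹) _ x :=
    (hasDerivAt_inv hbx).comp_hasFDerivAt (h₂ := fun t => t⁻¹) x hb'.hasFDerivAt
  have hderiv := hinv.fun_neg.fun_mul
    ((((hgrad Y).mul_const (Z a)).fun_add ((hgrad Z).mul_const (Y a))).fun_sub
      ((hgrad (Pi.single a 1)).mul_const (Y ⬝ᵥ Z)))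
  rw [← fderiv_apply_eq_grad_dotProduct, hev.fderiv_eq, hderiv.fderiv]
  simp only [_root_.add_apply, _root_.sub_apply, _root_.smul_apply, _root_.neg_apply,
    hgrad', ha, fderiv_apply_eq_grad_dotProduct, smul_eq_mul]
  rw [dotProduct_single_one]
  ring

lemma curvature_confFlat (hb : ContDiffAt ℝ 2 b x) (hbx : b x ≠ 0) (X Y Z : Fin n → ℝ) :
    (confFlat b).curvature x X Y Z =
      (b x)⁻¹ • ((Y ⬝ᵥ hess b x *ᵥ Z) • X - (X ⬝ᵥ hess b x *ᵥ Z) • Y +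
          (Y ⬝ᵥ Z) • (hess b x *ᵥ X) - (X ⬝ᵥ Z) • (hess b x *ᵥ Y)) -
        ((grad b x ⬝ᵥ grad b x) / b x ^ 2) • ((Y ⬝ᵥ Z) • X - (X ⬝ᵥ Z) • Y) := by
  have hb' : DifferentiableAt ℝ b x := hb.differentiableAt (by simp)
  ext a
  rw [Metric.curvature_apply_eq_connForm (differentiableAt_christoffel_confFlat hb hbx),
    grad_connForm_confFlat_dotProduct hb hbx, grad_connForm_confFlat_dotProduct hb hbx]
  simp only [connForm_confFlat hb' hbx, dotProduct_smul, dotProduct_add, dotProduct_sub,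
    Pi.smul_apply, Pi.add_apply, Pi.sub_apply, smul_eq_mul,
    dotProduct_hess_mulVec_comm hb Y X, dotProduct_comm _ (grad b x),
    dotProduct_comm Y X]
  field_simp
  ring

end ConformallyFlat

section GramTrace

variable {m n : ℕ} (T : Matrix (Fin m) (Fin n) ℝ) {E : Type*} [AddCommGroup E] [Module ℝ E]

/-- The trace `∑ᵢⱼ Sⁱʲ Aᵢⱼ` with respect to the Gram matrix `S = T Tᵀ` of the rows of `T`. -/
def gramTrace (A : Fin m → Fin m → E) : E := ∑ i, ∑ j, (T * Tᵀ)⁻¹ i j • A i j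

/-- The vector of the row space of `T` whose scalar products with the rows of `T` are the entries
of `w`. -/
def tangentLift (w : Fin m → ℝ) : Fin n → ℝ := Tᵀ *ᵥ (T * Tᵀ)⁻¹ *ᵥ w

lemma isSymm_gram : (T * Tᵀ).IsSymm := by
  rw [Matrix.IsSymm, transpose_mul, transpose_transpose]

lemma gramTrace_add (A B : Fin m → Fin m → E) :
    gramTrace T (fun i j => A i j + B i j) = gramTrace T A + gramTrace T B := by
  simp only [gramTrace, smul_add, Finset.sum_add_distrib]

lemma gramTrace_sub (A B : Fin m → Fin m → E) :
    gramTrace T (fun i j => A i j - B i j) = gramTrace T A - gramTrace T B := by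
  simp only [gramTrace, smul_sub, Finset.sum_sub_distrib]

lemma gramTrace_smul (c : ℝ) (A : Fin m → Fin m → E) :
    gramTrace T (fun i j => c • A i j) = c • gramTrace T A := by
  simp only [gramTrace, Finset.smul_sum, smul_comm _ c]

lemma gramTrace_smul_const (A : Fin m → Fin m → ℝ) (v : E) :
    gramTrace T (fun i j => A i j • v) = gramTrace T A • v := by
  simp only [gramTrace, Finset.sum_smul, smul_smul, smul_eq_mul]

lemma gramTrace_smul_row_left (w : Fin m → ℝ) :
    gramTrace T (fun i j => w j • T i) = tangentLift T w := by
  ext a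
  simp only [gramTrace, tangentLift, mulVec, dotProduct, Finset.sum_apply, Pi.smul_apply,
    smul_eq_mul, Finset.mul_sum, Matrix.transpose_apply]
  exact Finset.sum_congr rfl fun i _ => Finset.sum_congr rfl fun j _ => by ring

lemma gramTrace_swap (A : Fin m → Fin m → E) :
    gramTrace T (fun i j => A j i) = gramTrace T A := by
  have hS : (T * Tᵀ)⁻¹.IsSymm := (isSymm_gram T).inv
  rw [gramTrace, Finset.sum_comm]
  simp only [hS.apply, gramTrace]

lemma gramTrace_smul_row_right (w : Fin m → ℝ) :
    gramTrace T (fun i j => w i • T j) = tangentLift T w :=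
  (gramTrace_swap T fun i j => w j • T i).trans (gramTrace_smul_row_left T w)

lemma gramTrace_apply_eq_trace (M : Matrix (Fin m) (Fin m) ℝ) :
    gramTrace T (fun i j => M i j) = ((T * Tᵀ)⁻¹ * M).trace := by
  rw [← gramTrace_swap]
  rfl

lemma gramTrace_row_dotProduct_mulVec_row (H : Matrix (Fin n) (Fin n) ℝ) :
    gramTrace T (fun i j => T i ⬝ᵥ H *ᵥ T j) = (Tᵀ * (T * Tᵀ)⁻¹ * T * H).trace := by
  have hM (i j) : T i ⬝ᵥ H *ᵥ T j = (T * (H * Tᵀ)) i j := rfl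
  simp only [hM, gramTrace_apply_eq_trace]
  rw [← Matrix.mul_assoc T, ← Matrix.mul_assoc, Matrix.trace_mul_comm]
  simp only [Matrix.mul_assoc]

variable {T}

lemma gramTrace_row_dotProduct_row (hT : IsUnit (T * Tᵀ).det) :
    gramTrace T (fun i j => T i ⬝ᵥ T j) = m := by
  have hM (i j) : T i ⬝ᵥ T j = (T * Tᵀ) i j := rfl
  simp only [hM, gramTrace_apply_eq_trace]
  rw [Matrix.nonsing_inv_mul _ hT, Matrix.trace_one, Fintype.card_fin]

lemma mulVec_tangentLift (hT : IsUnit (T * Tᵀ).det) (w : Fin m → ℝ) :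
    T *ᵥ tangentLift T w = w := by
  rw [tangentLift, mulVec_mulVec, mulVec_mulVec, Matrix.mul_nonsing_inv _ hT, one_mulVec]

lemma dotProduct_tangentLift {ν : Fin n → ℝ} (hν : T *ᵥ ν = 0) (w : Fin m → ℝ) :
    ν ⬝ᵥ tangentLift T w = 0 := by
  rw [tangentLift, dotProduct_mulVec, vecMul_transpose, hν, zero_dotProduct]

end GramTrace

section Normal

variable {T : Matrix (Fin 2) (Fin 3) ℝ}

/-- The Euclidean normal of the plane spanned by the rows of `T`. Its squared length is the Gram
determinant of the rows. -/
def crossRows (T : Matrix (Fin 2) (Fin 3) ℝ) : Fin 3 → ℝ := T 0 ⨯₃ T 1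

lemma mulVec_crossRows : T *ᵥ crossRows T = 0 := by
  ext i
  fin_cases i
  · exact dot_self_cross _ _
  · exact dot_cross_self _ _

lemma det_gram_eq_crossRows_dotProduct_self :
    (T * Tᵀ).det = crossRows T ⬝ᵥ crossRows T := by
  rw [crossRows, cross_dot_cross, Matrix.det_fin_two]
  rfl

lemma crossRows_dotProduct_self_pos (hT : crossRows T ≠ 0) : 0 < crossRows T ⬝ᵥ crossRows T := by
  simpa using dotProduct_self_star_pos_iff.mpr hT

lemma isUnit_det_gram (hT : crossRows T ≠ 0) : IsUnit (T * Tᵀ).det := by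
  rw [det_gram_eq_crossRows_dotProduct_self]
  exact (crossRows_dotProduct_self_pos hT).ne'.isUnit

lemma tangentProj_add_normalProj (hT : crossRows T ≠ 0) :
    Tᵀ * (T * Tᵀ)⁻¹ * T +
      (crossRows T ⬝ᵥ crossRows T)⁻¹ • vecMulVec (crossRows T) (crossRows T) = 1 := by
  have hν : crossRows T ⬝ᵥ crossRows T ≠ 0 := (crossRows_dotProduct_self_pos hT).ne'
  have hadj : Tᵀ * (T * Tᵀ).adjugate * T + vecMulVec (crossRows T) (crossRows T) =
      (crossRows T ⬝ᵥ crossRows T) • (1 : Matrix (Fin 3) (Fin 3) ℝ) := by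
    ext a c
    fin_cases a <;> fin_cases c <;>
      simp [Matrix.adjugate_fin_two, Matrix.mul_apply, crossRows, cross_apply, dotProduct,
        Fin.sum_univ_succ] <;> ring
  rw [Matrix.inv_def, det_gram_eq_crossRows_dotProduct_self, Ring.inverse_eq_inv',
    Matrix.mul_smul, Matrix.smul_mul, ← smul_add, hadj, inv_smul_smul₀ hν]

lemma tangentLift_mulVec (hT : crossRows T ≠ 0) (v : Fin 3 → ℝ) :
    tangentLift T (T *ᵥ v) =
      v - ((crossRows T ⬝ᵥ v) / (crossRows T ⬝ᵥ crossRows T)) • crossRows T := by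
  rw [tangentLift, mulVec_mulVec, mulVec_mulVec,
    eq_sub_of_add_eq (tangentProj_add_normalProj hT), sub_mulVec, one_mulVec, smul_mulVec,
    vecMulVec_mulVec, op_smul_eq_smul, smul_smul, div_eq_inv_mul]

lemma gramTrace_row_dotProduct_mulVec_row_eq (hT : crossRows T ≠ 0)
    (H : Matrix (Fin 3) (Fin 3) ℝ) :
    gramTrace T (fun i j => T i ⬝ᵥ H *ᵥ T j) = H.trace -
      (crossRows T ⬝ᵥ H *ᵥ crossRows T) / (crossRows T ⬝ᵥ crossRows T) := by
  rw [gramTrace_row_dotProduct_mulVec_row,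
    eq_sub_of_add_eq (tangentProj_add_normalProj hT), sub_mul, one_mul, Matrix.trace_sub,
    Matrix.smul_mul, Matrix.trace_smul, vecMulVec_mul, trace_vecMulVec,
    dotProduct_comm _ (crossRows T ᵥ* H), ← dotProduct_mulVec, smul_eq_mul, div_eq_inv_mul]

lemma smul_crossRows_add_smul_tangentLift_eq_zero_iff (hT : crossRows T ≠ 0) (A c : ℝ)
    (w : Fin 2 → ℝ) :
    A • crossRows T + c • tangentLift T w = 0 ↔ A = 0 ∧ c • w = 0 := by
  have hν : crossRows T ⬝ᵥ crossRows T ≠ 0 := (crossRows_dotProduct_self_pos hT).ne'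
  constructor
  · intro h
    have hA := congrArg (crossRows T ⬝ᵥ ·) h
    have hw := congrArg (T *ᵥ ·) h
    simp only [dotProduct_add, dotProduct_smul, dotProduct_tangentLift mulVec_crossRows,
      smul_zero, add_zero, dotProduct_zero] at hA
    simp only [mulVec_add, mulVec_smul, mulVec_crossRows, mulVec_tangentLift (isUnit_det_gram hT),
      smul_zero, zero_add, mulVec_zero] at hw
    exact ⟨(smul_eq_zero.mp hA).resolve_right hν, hw⟩
  · rintro ⟨rfl, hw⟩
    rw [tangentLift, ← mulVec_smul, ← mulVec_smul, hw, mulVec_zero, mulVec_zero, zero_smul,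
      add_zero]

end Normal

section ScaledPullback

variable {m n : ℕ} {f : (Fin m → ℝ) → ℝ} {h : Metric n} {φ : (Fin m → ℝ) → (Fin n → ℝ)}

/-- The metric `f⁻¹ φ* h` on the domain of `φ`. -/
def scaledPullback (f : (Fin m → ℝ) → ℝ) (h : Metric n) (φ : (Fin m → ℝ) → (Fin n → ℝ)) :
    Metric m :=
  fun p => (f p)⁻¹ • pullback h φ p

lemma scaledPullback_one : scaledPullback (fun _ => 1) h φ = pullback h φ := by
  funext p
  rw [scaledPullback, inv_one, one_smul]

lemma hasConformalFactorOn_scaledPullback {U : Set (Fin m → ℝ)} (hf : ∀ p ∈ U, 0 < f p) :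
    HasConformalFactorOn (scaledPullback f h φ) h φ (fun p => √(f p)) U := fun p hp =>
  ⟨Real.sqrt_pos.mpr (hf p hp), by
    rw [Real.sq_sqrt (hf p hp).le, scaledPullback, smul_inv_smul₀ (hf p hp).ne']⟩

end ScaledPullback

section AffinePatch

variable {m n : ℕ} {q : Fin n → ℝ} {T : Matrix (Fin m) (Fin n) ℝ} {x : Fin m → ℝ}

/-- The affine parametrization of the plane through `q` spanned by the rows of `T`. -/
def affinePatch (q : Fin n → ℝ) (T : Matrix (Fin m) (Fin n) ℝ) (y : Fin m → ℝ) : Fin n → ℝ :=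
  q + y ᵥ* T

lemma contDiff_affinePatch {k : WithTop ℕ∞} : ContDiff ℝ k (affinePatch q T) :=
  contDiff_const.add T.vecMulLinear.toContinuousLinearMap.contDiff

lemma dmap_affinePatch (i : Fin m) : dmap (affinePatch q T) i x = T i := by
  have hφ : HasFDerivAt (affinePatch q T) T.vecMulLinear.toContinuousLinearMap x :=
    T.vecMulLinear.toContinuousLinearMap.hasFDerivAt.const_add q
  rw [dmap_eq_fderiv hφ.differentiableAt, hφ.fderiv]
  exact single_one_vecMul i T

variable {b : (Fin n → ℝ) → ℝ} {f : (Fin m → ℝ) → ℝ}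

lemma scaledPullback_confFlat_affinePatch (y : Fin m → ℝ) :
    scaledPullback f (confFlat b) (affinePatch q T) y =
      ((f y)⁻¹ * (b (affinePatch q T y) ^ 2)⁻¹) • (T * Tᵀ) := by
  ext i j
  simp only [scaledPullback, pullback, dmap_affinePatch, ip_confFlat, Matrix.smul_apply,
    Matrix.of_apply, smul_eq_mul, mul_assoc]
  rfl

lemma sum_inv_scaledPullback_smul (hT : IsUnit (T * Tᵀ).det) (hf : f x ≠ 0)
    (hb : b (affinePatch q T x) ≠ 0) {E : Type*} [AddCommGroup E] [Module ℝ E]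
    (A : Fin m → Fin m → E) :
    ∑ i, ∑ j, (scaledPullback f (confFlat b) (affinePatch q T) x)⁻¹ i j • A i j =
      (f x * b (affinePatch q T x) ^ 2) • gramTrace T A := by
  have hinv : (scaledPullback f (confFlat b) (affinePatch q T) x)⁻¹ =
      (f x * b (affinePatch q T x) ^ 2) • (T * Tᵀ)⁻¹ := Matrix.inv_eq_right_inv <| by
    rw [scaledPullback_confFlat_affinePatch, smul_mul_smul_comm, Matrix.mul_nonsing_inv _ hT,
      ← mul_inv, inv_mul_cancel₀ (mul_ne_zero hf (pow_ne_zero 2 hb)), one_smul]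
  simp only [hinv, Matrix.smul_apply, smul_assoc, ← Finset.smul_sum, gramTrace]

lemma hasHarmonicCoordsAt_scaledPullback {T : Matrix (Fin 2) (Fin n) ℝ} {x : Fin 2 → ℝ}
    {f : (Fin 2 → ℝ) → ℝ} (hT : IsUnit (T * Tᵀ).det) (hf : DifferentiableAt ℝ f x)
    (hfx : f x ≠ 0) (hb : DifferentiableAt ℝ b (affinePatch q T x))
    (hbx : b (affinePatch q T x) ≠ 0) :
    (scaledPullback f (confFlat b) (affinePatch q T)).HasHarmonicCoordsAt x := by
  have hφ : DifferentiableAt ℝ (affinePatch q T) x :=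
    (contDiff_affinePatch (k := 1)).differentiable (by simp) x
  refine hasHarmonicCoordsAt_of_eq_smul scaledPullback_confFlat_affinePatch ?_ ?_ (isSymm_gram T)
    hT
  · exact (hf.inv hfx).mul (((hb.comp x hφ).pow 2).inv (pow_ne_zero 2 hbx))
  · exact mul_ne_zero (inv_ne_zero hfx) (inv_ne_zero (pow_ne_zero 2 hbx))

lemma pullbackConn_sub {h : Metric n} {φ V W : (Fin m → ℝ) → (Fin n → ℝ)}
    (hV : DifferentiableAt ℝ V x) (hW : DifferentiableAt ℝ W x) (i : Fin m) :
    pullbackConn h φ i (fun y => V y - W y) x =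
      pullbackConn h φ i V x - pullbackConn h φ i W x := by
  simp only [pullbackConn_eq_add_connForm, dmap_eq_fderiv hV, dmap_eq_fderiv hW,
    dmap_eq_fderiv (hV.fun_sub hW), fderiv_fun_sub hV hW, _root_.sub_apply, Metric.connForm_sub]
  abel

lemma pullbackConn_confFlat_affinePatch_smul (hb : DifferentiableAt ℝ b (affinePatch q T x))
    (hbx : b (affinePatch q T x) ≠ 0) {F : (Fin m → ℝ) → ℝ} (hF : DifferentiableAt ℝ F x)
    (v : Fin n → ℝ) (i : Fin m) :
    pullbackConn (confFlat b) (affinePatch q T) i (fun y => F y • v) x =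
      pd i F x • v - (F x / b (affinePatch q T x)) •
        ((grad b (affinePatch q T x) ⬝ᵥ T i) • v + (grad b (affinePatch q T x) ⬝ᵥ v) • T i -
          (T i ⬝ᵥ v) • grad b (affinePatch q T x)) := by
  have hdmap : dmap (fun y => F y • v) i x = pd i F x • v := by
    ext a
    exact pd_mul_const hF (v a)
  rw [pullbackConn_eq_add_connForm, hdmap, dmap_affinePatch, Metric.connForm_smul,
    connForm_confFlat hb hbx]
  module

end AffinePatch

section NormalFields

variable {m n : ℕ} {q : Fin n → ℝ} {T : Matrix (Fin m) (Fin n) ℝ} {x : Fin m → ℝ}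
  {b : (Fin n → ℝ) → ℝ} {P : (Fin m → ℝ) → ℝ} {ν : Fin n → ℝ}

lemma pd_comp_affinePatch {F : (Fin n → ℝ) → ℝ} (hF : DifferentiableAt ℝ F (affinePatch q T x))
    (i : Fin m) :
    pd i (fun y => F (affinePatch q T y)) x = grad F (affinePatch q T x) ⬝ᵥ T i := by
  rw [pd_comp hF ((contDiff_affinePatch (k := 1)).differentiable (by simp) x), dmap_affinePatch]

lemma pullbackConn_smul_normal (hb : DifferentiableAt ℝ b (affinePatch q T x))
    (hbx : b (affinePatch q T x) ≠ 0) (hP : DifferentiableAt ℝ P x) (hν : T *ᵥ ν = 0)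
    (j : Fin m) :
    pullbackConn (confFlat b) (affinePatch q T) j (fun y => (b (affinePatch q T y) * P y) • ν) x =
      (b (affinePatch q T x) * pd j P x) • ν -
        (P x * (grad b (affinePatch q T x) ⬝ᵥ ν)) • T j := by
  have hφ : DifferentiableAt ℝ (affinePatch q T) x :=
    (contDiff_affinePatch (k := 1)).differentiable (by simp) x
  have hTν : T j ⬝ᵥ ν = 0 := congrFun hν j
  have hbφ : DifferentiableAt ℝ (fun y => b (affinePatch q T y)) x := hb.comp x hφ
  rw [pullbackConn_confFlat_affinePatch_smul hb hbx (hbφ.fun_mul hP), pd_mul hbφ hP,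
    pd_comp_affinePatch hb, hTν, mul_div_cancel_left₀ _ hbx]
  module

lemma pullbackConn_pullbackConn_smul_normal (hb : ContDiffAt ℝ 2 b (affinePatch q T x))
    (hbx : b (affinePatch q T x) ≠ 0) (hP : ContDiffAt ℝ 2 P x) (hν : T *ᵥ ν = 0)
    (i j : Fin m) :
    pullbackConn (confFlat b) (affinePatch q T) i
        (pullbackConn (confFlat b) (affinePatch q T) j
          fun y => (b (affinePatch q T y) * P y) • ν) x =
      (b (affinePatch q T x) * pd i (pd j P) x) • ν -
        (grad b (affinePatch q T x) ⬝ᵥ ν) • (pd j P x • T i + pd i P x • T j) -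
        P x • (T i ⬝ᵥ hess b (affinePatch q T x) *ᵥ ν) • T j +
        (P x * (grad b (affinePatch q T x) ⬝ᵥ ν) / b (affinePatch q T x)) •
          ((T *ᵥ grad b (affinePatch q T x)) j • T i + (T *ᵥ grad b (affinePatch q T x)) i • T j -
            (T i ⬝ᵥ T j) • grad b (affinePatch q T x)) := by
  have hφ : ContDiffAt ℝ 2 (affinePatch q T) x := contDiff_affinePatch.contDiffAt
  have hφ' : DifferentiableAt ℝ (affinePatch q T) x := hφ.differentiableAt (by simp)
  have hb' : DifferentiableAt ℝ b (affinePatch q T x) := hb.differentiableAt (by simp)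
  have hP' : DifferentiableAt ℝ P x := hP.differentiableAt (by simp)
  have hcomm (k) : (T *ᵥ grad b (affinePatch q T x)) k = grad b (affinePatch q T x) ⬝ᵥ T k :=
    dotProduct_comm _ _
  have hbφ : DifferentiableAt ℝ (fun y => b (affinePatch q T y)) x := hb'.comp x hφ'
  have hPj : DifferentiableAt ℝ (pd j P) x :=
    (contDiffAt_pd (k := 1) (by simpa [one_add_one_eq_two] using hP) j).differentiableAt (by simp)
  have hgrad : DifferentiableAt ℝ (fun z => grad b z ⬝ᵥ ν) (affinePatch q T x) :=
    (contDiffAt_grad_dotProduct (k := 1) (by simpa [one_add_one_eq_two] using hb) ν)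
      |>.differentiableAt (by simp)
  have hgradφ : DifferentiableAt ℝ (fun y => grad b (affinePatch q T y) ⬝ᵥ ν) x :=
    hgrad.comp x hφ'
  have hev : (pullbackConn (confFlat b) (affinePatch q T) j
        fun y => (b (affinePatch q T y) * P y) • ν) =ᶠ[𝓝 x] fun y =>
      (b (affinePatch q T y) * pd j P y) • ν -
        (P y * (grad b (affinePatch q T y) ⬝ᵥ ν)) • T j := by
    filter_upwards [hφ'.continuousAt.eventually (hb.eventually (by simp)),
      hbφ.continuousAt.eventually_ne hbx, hP.eventually (by simp)] with y hby hby0 hPy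
    exact pullbackConn_smul_normal (hby.differentiableAt (by simp)) hby0
      (hPy.differentiableAt (by simp)) hν j
  rw [pullbackConn_congr _ hev, pullbackConn_sub ((hbφ.fun_mul hPj).smul_const ν)
    ((hP'.fun_mul hgradφ).smul_const (T j)), pullbackConn_smul_normal hb' hbx hPj hν,
    pullbackConn_confFlat_affinePatch_smul hb' hbx (hP'.fun_mul hgradφ), pd_mul hP' hgradφ,
    pd_comp_affinePatch hgrad, grad_grad_dotProduct hb, dotProduct_comm (_ *ᵥ ν), hcomm, hcomm]
  module

lemma gramTrace_pullbackConn_pullbackConn_smul_normal (hT : IsUnit (T * Tᵀ).det)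
    (hb : ContDiffAt ℝ 2 b (affinePatch q T x)) (hbx : b (affinePatch q T x) ≠ 0)
    (hP : ContDiffAt ℝ 2 P x) (hν : T *ᵥ ν = 0) :
    gramTrace T (fun i j => pullbackConn (confFlat b) (affinePatch q T) i
        (pullbackConn (confFlat b) (affinePatch q T) j
          fun y => (b (affinePatch q T y) * P y) • ν) x) =
      (b (affinePatch q T x) * gramTrace T (hess P x)) • ν -
        (2 * (grad b (affinePatch q T x) ⬝ᵥ ν)) • tangentLift T (grad P x) -
        P x • tangentLift T (T *ᵥ hess b (affinePatch q T x) *ᵥ ν) +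
        (P x * (grad b (affinePatch q T x) ⬝ᵥ ν) / b (affinePatch q T x)) •
          ((2 : ℝ) • tangentLift T (T *ᵥ grad b (affinePatch q T x)) -
            (m : ℝ) • grad b (affinePatch q T x)) := by
  have hhess : gramTrace T (fun i j => (b (affinePatch q T x) * pd i (pd j P) x) • ν) =
      (b (affinePatch q T x) * gramTrace T (hess P x)) • ν := by
    simp only [mul_smul, gramTrace_smul]
    rw [gramTrace_smul_const]
    rfl
  have hgrad : gramTrace T (fun i j => pd j P x • T i + pd i P x • T j) =
      (2 : ℝ) • tangentLift T (grad P x) := by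
    rw [gramTrace_add, two_smul]
    exact congrArg₂ _ (gramTrace_smul_row_left T (grad P x)) (gramTrace_smul_row_right T (grad P x))
  have hrow : gramTrace T (fun i j => (T i ⬝ᵥ hess b (affinePatch q T x) *ᵥ ν) • T j) =
      tangentLift T (T *ᵥ hess b (affinePatch q T x) *ᵥ ν) :=
    gramTrace_smul_row_right T (T *ᵥ hess b (affinePatch q T x) *ᵥ ν)
  have hquad (v : Fin n → ℝ) :
      gramTrace T (fun i j => (T *ᵥ v) j • T i + (T *ᵥ v) i • T j - (T i ⬝ᵥ T j) • v) =
        (2 : ℝ) • tangentLift T (T *ᵥ v) - (m : ℝ) • v := by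
    rw [gramTrace_sub, gramTrace_add, gramTrace_smul_row_left, gramTrace_smul_row_right,
      gramTrace_smul_const, gramTrace_row_dotProduct_row hT, two_smul]
  simp only [pullbackConn_pullbackConn_smul_normal hb hbx hP hν]
  rw [gramTrace_add, gramTrace_sub, gramTrace_sub, hhess, gramTrace_smul, hgrad, gramTrace_smul,
    hrow, gramTrace_smul, hquad, smul_smul, mul_comm _ (2 : ℝ)]

lemma gramTrace_curvature_smul_normal (hT : IsUnit (T * Tᵀ).det) {z : Fin n → ℝ}
    (hb : ContDiffAt ℝ 2 b z) (hbz : b z ≠ 0) (hν : T *ᵥ ν = 0) (c : ℝ) :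
    gramTrace T (fun i j => (confFlat b).curvature z (T i) (c • ν) (T j)) =
      c • ((b z)⁻¹ • (tangentLift T (T *ᵥ hess b z *ᵥ ν) -
        gramTrace T (fun i j => T i ⬝ᵥ hess b z *ᵥ T j) • ν - (m : ℝ) • (hess b z *ᵥ ν)) +
        (m * (grad b z ⬝ᵥ grad b z) / b z ^ 2) • ν) := by
  have hTν (i) : ν ⬝ᵥ T i = 0 := (dotProduct_comm _ _).trans (congrFun hν i)
  have hcurv (i j) : (confFlat b).curvature z (T i) (c • ν) (T j) =
      c • ((b z)⁻¹ • ((ν ⬝ᵥ hess b z *ᵥ T j) • T i - (T i ⬝ᵥ hess b z *ᵥ T j) • ν -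
        (T i ⬝ᵥ T j) • (hess b z *ᵥ ν)) +
        ((grad b z ⬝ᵥ grad b z) / b z ^ 2) • (T i ⬝ᵥ T j) • ν) := by
    rw [Metric.curvature_smul, curvature_confFlat hb hbz, hTν]
    module
  have hrow : gramTrace T (fun i j => (ν ⬝ᵥ hess b z *ᵥ T j) • T i) =
      tangentLift T (T *ᵥ hess b z *ᵥ ν) := by
    simp only [dotProduct_hess_mulVec_comm hb ν]
    exact gramTrace_smul_row_left T (T *ᵥ hess b z *ᵥ ν)
  simp only [hcurv]
  rw [gramTrace_smul, gramTrace_add, gramTrace_smul, gramTrace_sub, gramTrace_sub, gramTrace_smul,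
    gramTrace_smul_const, gramTrace_smul_const, gramTrace_smul_const, hrow,
    gramTrace_row_dotProduct_row hT]
  module

end NormalFields

section Plane

variable {q : Fin 3 → ℝ} {T : Matrix (Fin 2) (Fin 3) ℝ} {x : Fin 2 → ℝ} {b : (Fin 3 → ℝ) → ℝ}
  {f : (Fin 2 → ℝ) → ℝ}

/-- The function `P` for which the tension field of the plane `affinePatch q T` with respect to
the metrics `scaledPullback f (confFlat b) (affinePatch q T)` and `confFlat b` is
`(b P) • crossRows T`. -/
def normalTension (b : (Fin 3 → ℝ) → ℝ) (q : Fin 3 → ℝ) (T : Matrix (Fin 2) (Fin 3) ℝ)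
    (f : (Fin 2 → ℝ) → ℝ) (y : Fin 2 → ℝ) : ℝ :=
  2 * f y * (grad b (affinePatch q T y) ⬝ᵥ crossRows T) / (crossRows T ⬝ᵥ crossRows T)

/-- The zeroth order coefficient of the normal part of the bitension field of a plane, viewed as a
linear differential expression in `normalTension`. -/
def bitensionPotential (b : (Fin 3 → ℝ) → ℝ) (T : Matrix (Fin 2) (Fin 3) ℝ) (z : Fin 3 → ℝ) : ℝ :=
  (hess b z).trace + (crossRows T ⬝ᵥ hess b z *ᵥ crossRows T) / (crossRows T ⬝ᵥ crossRows T) -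
    2 * (grad b z ⬝ᵥ grad b z) / b z -
    2 * (grad b z ⬝ᵥ crossRows T) ^ 2 / (b z * (crossRows T ⬝ᵥ crossRows T))

lemma contDiffAt_normalTension {k : WithTop ℕ∞} (hb : ContDiffAt ℝ (k + 1) b (affinePatch q T x))
    (hf : ContDiffAt ℝ k f x) : ContDiffAt ℝ k (normalTension b q T f) x :=
  ((contDiffAt_const.mul hf).mul ((contDiffAt_grad_dotProduct hb _).comp x
    contDiff_affinePatch.contDiffAt)).div_const _

lemma tension_scaledPullback_affinePatch (hT : crossRows T ≠ 0)
    (hb : DifferentiableAt ℝ b (affinePatch q T x)) (hbx : b (affinePatch q T x) ≠ 0)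
    (hf : DifferentiableAt ℝ f x) (hfx : f x ≠ 0) :
    tension (scaledPullback f (confFlat b) (affinePatch q T)) (confFlat b) (affinePatch q T) x =
      (b (affinePatch q T x) * normalTension b q T f x) • crossRows T := by
  have hrow (k) : grad b (affinePatch q T x) ⬝ᵥ T k = (T *ᵥ grad b (affinePatch q T x)) k :=
    dotProduct_comm _ _
  have hconn (i j) : pullbackConn (confFlat b) (affinePatch q T) i (dmap (affinePatch q T) j) x =
      -(b (affinePatch q T x))⁻¹ • ((T *ᵥ grad b (affinePatch q T x)) i • T j +
        (T *ᵥ grad b (affinePatch q T x)) j • T i -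
        (T i ⬝ᵥ T j) • grad b (affinePatch q T x)) := by
    have hone : dmap (affinePatch q T) j = fun _ => (1 : ℝ) • T j := by
      funext y
      rw [dmap_affinePatch, one_smul]
    rw [hone, pullbackConn_confFlat_affinePatch_smul hb hbx (differentiableAt_const _), pd_const,
      hrow, hrow]
    module
  rw [tension_of_hasHarmonicCoordsAt _
      (hasHarmonicCoordsAt_scaledPullback (isUnit_det_gram hT) hf hfx hb hbx),
    sum_inv_scaledPullback_smul (isUnit_det_gram hT) hfx hbx]
  simp only [hconn]
  rw [gramTrace_smul, gramTrace_sub, gramTrace_add, gramTrace_smul_row_left,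
    gramTrace_smul_row_right, gramTrace_smul_const,
    gramTrace_row_dotProduct_row (isUnit_det_gram hT), tangentLift_mulVec hT, normalTension,
    dotProduct_comm (crossRows T) (grad _ _)]
  match_scalars <;> field_simp <;> ring

lemma bitension_scaledPullback_affinePatch (hT : crossRows T ≠ 0)
    (hb : ContDiffAt ℝ 3 b (affinePatch q T x)) (hbx : b (affinePatch q T x) ≠ 0)
    (hf : ContDiffAt ℝ 2 f x) (hfx : f x ≠ 0) :
    bitension (scaledPullback f (confFlat b) (affinePatch q T)) (confFlat b) (affinePatch q T) x =
      (f x * b (affinePatch q T x) ^ 2) •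
        ((b (affinePatch q T x) * gramTrace T (hess (normalTension b q T f) x) +
            normalTension b q T f x * bitensionPotential b T (affinePatch q T x)) • crossRows T -
          (2 * (grad b (affinePatch q T x) ⬝ᵥ crossRows T)) •
            tangentLift T (grad (normalTension b q T f) x)) := by
  have hS : IsUnit (T * Tᵀ).det := isUnit_det_gram hT
  have hb₂ : ContDiffAt ℝ 2 b (affinePatch q T x) := hb.of_le (by norm_num)
  have hb' : DifferentiableAt ℝ b (affinePatch q T x) := hb.differentiableAt (by simp)
  have hφ : ContinuousAt (affinePatch q T) x :=
    (contDiff_affinePatch (k := 0)).continuous.continuousAt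
  have hP : ContDiffAt ℝ 2 (normalTension b q T f) x :=
    contDiffAt_normalTension (hb.of_le (by norm_num)) hf
  have hτ : tension (scaledPullback f (confFlat b) (affinePatch q T)) (confFlat b)
      (affinePatch q T) =ᶠ[𝓝 x]
        fun y => (b (affinePatch q T y) * normalTension b q T f y) • crossRows T := by
    filter_upwards [hφ.eventually (hb.eventually (by simp)),
      (hb'.continuousAt.comp hφ).eventually_ne hbx, hf.eventually (by simp),
      hf.continuousAt.eventually_ne hfx] with y hby hby0 hfy hfy0
    exact tension_scaledPullback_affinePatch hT (hby.differentiableAt (by simp)) hby0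
      (hfy.differentiableAt (by simp)) hfy0
  have hconn (i j) : pullbackConn (confFlat b) (affinePatch q T) i
      (pullbackConn (confFlat b) (affinePatch q T) j
        (tension (scaledPullback f (confFlat b) (affinePatch q T)) (confFlat b)
          (affinePatch q T))) x = _ :=
    pullbackConn_congr _ (hτ.eventually_nhds.mono fun y hy => pullbackConn_congr _ hy)
  rw [bitension_of_hasHarmonicCoordsAt _ (hasHarmonicCoordsAt_scaledPullback hS
      (hf.differentiableAt (by simp)) hfx hb' hbx),
    sum_inv_scaledPullback_smul hS hfx hbx, sum_inv_scaledPullback_smul hS hfx hbx]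
  simp only [hconn, hτ.self_of_nhds, dmap_affinePatch]
  rw [gramTrace_pullbackConn_pullbackConn_smul_normal hS hb₂ hbx hP mulVec_crossRows,
    gramTrace_curvature_smul_normal hS hb₂ hbx mulVec_crossRows, tangentLift_mulVec hT,
    tangentLift_mulVec hT, gramTrace_row_dotProduct_mulVec_row_eq hT, bitensionPotential,
    dotProduct_comm (crossRows T) (grad _ _)]
  match_scalars <;> field_simp <;> ring

end Plane

section Characterization

variable {q : Fin 3 → ℝ} {T : Matrix (Fin 2) (Fin 3) ℝ} {x : Fin 2 → ℝ} {b : (Fin 3 → ℝ) → ℝ}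
  {f : (Fin 2 → ℝ) → ℝ} {U : Set (Fin 2 → ℝ)}

lemma tension_scaledPullback_affinePatch_eq_zero_iff (hT : crossRows T ≠ 0)
    (hb : DifferentiableAt ℝ b (affinePatch q T x)) (hbx : b (affinePatch q T x) ≠ 0)
    (hf : DifferentiableAt ℝ f x) (hfx : f x ≠ 0) :
    tension (scaledPullback f (confFlat b) (affinePatch q T)) (confFlat b) (affinePatch q T) x = 0 ↔
      normalTension b q T f x = 0 := by
  simp [tension_scaledPullback_affinePatch hT hb hbx hf hfx, hT, hbx]

lemma bitension_scaledPullback_affinePatch_eq_zero_iff (hT : crossRows T ≠ 0)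
    (hb : ContDiffAt ℝ 3 b (affinePatch q T x)) (hbx : b (affinePatch q T x) ≠ 0)
    (hf : ContDiffAt ℝ 2 f x) (hfx : f x ≠ 0) :
    bitension (scaledPullback f (confFlat b) (affinePatch q T)) (confFlat b) (affinePatch q T) x =
        0 ↔
      b (affinePatch q T x) * gramTrace T (hess (normalTension b q T f) x) +
          normalTension b q T f x * bitensionPotential b T (affinePatch q T x) = 0 ∧
        normalTension b q T f x • grad (normalTension b q T f) x = 0 := by
  have hW : crossRows T ⬝ᵥ crossRows T ≠ 0 := (crossRows_dotProduct_self_pos hT).ne'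
  rw [bitension_scaledPullback_affinePatch hT hb hbx hf hfx,
    smul_eq_zero_iff_right (mul_ne_zero hfx (pow_ne_zero 2 hbx)), sub_eq_add_neg, ← neg_smul,
    smul_crossRows_add_smul_tangentLift_eq_zero_iff hT]
  refine and_congr_right fun _ => ?_
  rw [smul_eq_zero, smul_eq_zero, normalTension]
  simp [hfx, hW]

lemma IsBiharmonicOn.exists_abs_normalTension_eq (hT : crossRows T ≠ 0) (hU : IsOpen U)
    (hUc : IsPreconnected U) (hb : ∀ p ∈ U, ContDiffAt ℝ 3 b (affinePatch q T p))
    (hbU : ∀ p ∈ U, b (affinePatch q T p) ≠ 0) (hf : ContDiffOn ℝ 2 f U) (hfU : ∀ p ∈ U, f p ≠ 0)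
    (hbih : IsBiharmonicOn (scaledPullback f (confFlat b) (affinePatch q T)) (confFlat b)
      (affinePatch q T) U) :
    ∃ c, ∀ p ∈ U, |normalTension b q T f p| = c := by
  have hf' (p) (hp : p ∈ U) : ContDiffAt ℝ 2 f p := hf.contDiffAt (hU.mem_nhds hp)
  refine exists_abs_eq_of_smul_grad_eq_zero hU hUc (fun p hp => ?_) fun p hp =>
    ((bitension_scaledPullback_affinePatch_eq_zero_iff hT (hb p hp) (hbU p hp) (hf' p hp)
      (hfU p hp)).mp (hbih p hp)).2
  exact ((contDiffAt_normalTension (k := 2) ((hb p hp).of_le (by norm_num))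
    (hf' p hp)).differentiableAt (by simp)).differentiableWithinAt

lemma isBiharmonicOn_affinePatch_iff_of_abs_normalTension_eq (hT : crossRows T ≠ 0)
    (hU : IsOpen U) (hb : ∀ p ∈ U, ContDiffAt ℝ 3 b (affinePatch q T p))
    (hbU : ∀ p ∈ U, b (affinePatch q T p) ≠ 0) (hf : ContDiffOn ℝ 2 f U) (hfU : ∀ p ∈ U, f p ≠ 0)
    {c : ℝ} (hc : 0 < c) (habs : ∀ p ∈ U, |normalTension b q T f p| = c) :
    IsBiharmonicOn (scaledPullback f (confFlat b) (affinePatch q T)) (confFlat b)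
        (affinePatch q T) U ↔
      ∀ p ∈ U, bitensionPotential b T (affinePatch q T p) = 0 := by
  have hf' (p) (hp : p ∈ U) : ContDiffAt ℝ 2 f p := hf.contDiffAt (hU.mem_nhds hp)
  have hne (p) (hp : p ∈ U) : normalTension b q T f p ≠ 0 :=
    abs_pos.mp ((habs p hp).symm ▸ hc)
  have hgrad (p) (hp : p ∈ U) : grad (normalTension b q T f) p = 0 := by
    refine (smul_eq_zero.mp (smul_grad_eq_zero_of_abs_eventually_eq ?_
      (Filter.eventually_of_mem (hU.mem_nhds hp) habs))).resolve_left (hne p hp)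
    exact (contDiffAt_normalTension (k := 2) ((hb p hp).of_le (by norm_num))
      (hf' p hp)).differentiableAt (by simp)
  refine forall₂_congr fun p hp => ?_
  have hhess : hess (normalTension b q T f) p = 0 :=
    hess_eq_zero_of_grad_eventually_eq_zero (Filter.eventually_of_mem (hU.mem_nhds hp) hgrad)
  rw [bitension_scaledPullback_affinePatch_eq_zero_iff hT (hb p hp) (hbU p hp) (hf' p hp)
    (hfU p hp)]
  simp [hhess, hgrad p hp, gramTrace, hne p hp]

theorem isProperBiharmonicOn_affinePatch_iff (hT : crossRows T ≠ 0) (hU : IsOpen U)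
    (hUc : IsConnected U) (hb : ∀ p ∈ U, ContDiffAt ℝ 3 b (affinePatch q T p))
    (hbU : ∀ p ∈ U, b (affinePatch q T p) ≠ 0) (hf : ContDiffOn ℝ 2 f U)
    (hfU : ∀ p ∈ U, f p ≠ 0) :
    IsProperBiharmonicOn (scaledPullback f (confFlat b) (affinePatch q T)) (confFlat b)
        (affinePatch q T) U ↔
      (∀ p ∈ U, bitensionPotential b T (affinePatch q T p) = 0) ∧
        ∃ c > 0, ∀ p ∈ U, |normalTension b q T f p| = c := by
  have hharm : IsHarmonicOn (scaledPullback f (confFlat b) (affinePatch q T)) (confFlat b)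
      (affinePatch q T) U ↔ ∀ p ∈ U, normalTension b q T f p = 0 :=
    forall₂_congr fun p hp => tension_scaledPullback_affinePatch_eq_zero_iff hT
      ((hb p hp).differentiableAt (by simp)) (hbU p hp)
      ((hf.contDiffAt (hU.mem_nhds hp)).differentiableAt (by simp)) (hfU p hp)
  have hbih {c : ℝ} (hc : 0 < c) (habs : ∀ p ∈ U, |normalTension b q T f p| = c) :=
    isBiharmonicOn_affinePatch_iff_of_abs_normalTension_eq hT hU hb hbU hf hfU hc habs
  rw [IsProperBiharmonicOn, hharm]
  constructor
  · rintro ⟨hzero, hnz⟩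
    obtain ⟨c, habs⟩ := hzero.exists_abs_normalTension_eq hT hU hUc.isPreconnected hb hbU hf hfU
    push Not at hnz
    obtain ⟨p₀, hp₀, hP₀⟩ := hnz
    have hc : 0 < c := habs p₀ hp₀ ▸ abs_pos.mpr hP₀
    exact ⟨(hbih hc habs).mp hzero, c, hc, habs⟩
  · rintro ⟨hpot, c, hc, habs⟩
    obtain ⟨p₀, hp₀⟩ := hUc.nonempty
    exact ⟨(hbih hc habs).mpr hpot,
      fun hP => abs_pos.mp ((habs p₀ hp₀).symm ▸ hc) (hP p₀ hp₀)⟩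

lemma isUnitNormalOn_affinePatch (hT : crossRows T ≠ 0)
    (hbU : ∀ p ∈ U, b (affinePatch q T p) ≠ 0) :
    IsUnitNormalOn (confFlat b) (affinePatch q T)
      (fun p => (b (affinePatch q T p) / √(crossRows T ⬝ᵥ crossRows T)) • crossRows T) U := by
  have hW : crossRows T ⬝ᵥ crossRows T ≠ 0 := (crossRows_dotProduct_self_pos hT).ne'
  have hW₀ : 0 ≤ crossRows T ⬝ᵥ crossRows T := (crossRows_dotProduct_self_pos hT).le
  refine fun p hp => ⟨?_, fun i => ?_⟩
  · have hbp := hbU p hp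
    simp only [ip_confFlat, smul_dotProduct, dotProduct_smul, smul_eq_mul]
    rw [← mul_assoc (_ / _), div_mul_div_comm, Real.mul_self_sqrt hW₀]
    field_simp
  · have hνT : crossRows T ⬝ᵥ T i = 0 :=
      (dotProduct_comm _ _).trans (congrFun mulVec_crossRows i)
    rw [ip_confFlat, dmap_affinePatch, smul_dotProduct, hνT, smul_zero, mul_zero]

theorem hasMeanCurvatureOn_affinePatch (hT : crossRows T ≠ 0)
    (hb : ∀ p ∈ U, DifferentiableAt ℝ b (affinePatch q T p))
    (hbU : ∀ p ∈ U, b (affinePatch q T p) ≠ 0) :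
    HasMeanCurvatureOn (confFlat b) (affinePatch q T)
      (fun p => (b (affinePatch q T p) / √(crossRows T ⬝ᵥ crossRows T)) • crossRows T)
      (fun p => (grad b (affinePatch q T p) ⬝ᵥ crossRows T) / √(crossRows T ⬝ᵥ crossRows T)) U := by
  refine ⟨isUnitNormalOn_affinePatch hT hbU, fun p hp => ?_⟩
  rw [meanCurvatureVector, ← scaledPullback_one, tension_scaledPullback_affinePatch hT (hb p hp)
    (hbU p hp) (differentiableAt_const _) one_ne_zero, normalTension, smul_smul, smul_smul,
    div_mul_div_comm, Real.mul_self_sqrt (crossRows_dotProduct_self_pos hT).le]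
  congr 1
  push_cast
  ring

end Characterization

section GraphPlane

variable {a₁ a₂ a₃ : ℝ} {β : ℝ → ℝ} {f : (Fin 2 → ℝ) → ℝ} {p : Fin 2 → ℝ}

/-- The coordinate tangent vectors `(1, 0, a₁)` and `(0, 1, a₂)` of `planeMap`, as matrix rows. -/
def planeRows (a₁ a₂ : ℝ) : Matrix (Fin 2) (Fin 3) ℝ := !![1, 0, a₁; 0, 1, a₂]

lemma planeMap_eq_affinePatch : planeMap a₁ a₂ a₃ = affinePatch ![0, 0, a₃] (planeRows a₁ a₂) := by
  funext p k
  fin_cases k <;> simp [planeMap, planeHeight, affinePatch, planeRows, vecMul_eq_sum]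
  ring

lemma affinePatch_planeRows_apply_two :
    affinePatch ![0, 0, a₃] (planeRows a₁ a₂) p 2 = planeHeight a₁ a₂ a₃ p := by
  rw [← planeMap_eq_affinePatch]
  rfl

lemma crossRows_planeRows : crossRows (planeRows a₁ a₂) = ![-a₁, -a₂, 1] := by
  ext k
  fin_cases k <;> simp [crossRows, planeRows, cross_apply]

lemma crossRows_planeRows_ne_zero : crossRows (planeRows a₁ a₂) ≠ 0 := fun h => by
  simpa [crossRows_planeRows] using congrFun h 2

lemma crossRows_planeRows_dotProduct_self :
    crossRows (planeRows a₁ a₂) ⬝ᵥ crossRows (planeRows a₁ a₂) = 1 + a₁ ^ 2 + a₂ ^ 2 := by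
  simp only [crossRows_planeRows, vec3_dotProduct, Matrix.cons_val]
  ring

lemma grad_dotProduct_crossRows_planeRows {z : Fin 3 → ℝ} (hβ : DifferentiableAt ℝ β (z 2)) :
    grad (fun y : Fin 3 → ℝ => β (y 2)) z ⬝ᵥ crossRows (planeRows a₁ a₂) = deriv β (z 2) := by
  rw [grad_comp_apply hβ, crossRows_planeRows, single_dotProduct]
  simp

lemma abs_normalTension_planeRows (hβ : DifferentiableAt ℝ β (planeHeight a₁ a₂ a₃ p))
    (hf : 0 < f p) :
    |normalTension (fun z => β (z 2)) ![0, 0, a₃] (planeRows a₁ a₂) f p| =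
      2 * f p * |deriv β (planeHeight a₁ a₂ a₃ p)| / (1 + a₁ ^ 2 + a₂ ^ 2) := by
  have hW : 0 < 1 + a₁ ^ 2 + a₂ ^ 2 := by positivity
  rw [normalTension,
    grad_dotProduct_crossRows_planeRows (by rwa [affinePatch_planeRows_apply_two]),
    affinePatch_planeRows_apply_two, crossRows_planeRows_dotProduct_self, abs_div, abs_mul,
    abs_of_pos hW, abs_of_pos (mul_pos two_pos hf)]

lemma bitensionPotential_planeRows {z : Fin 3 → ℝ} (hβ : ContDiffAt ℝ 2 β (z 2))
    (hβz : β (z 2) ≠ 0) :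
    bitensionPotential (fun y => β (y 2)) (planeRows a₁ a₂) z =
      (1 + (1 + a₁ ^ 2 + a₂ ^ 2)⁻¹) / β (z 2) *
        (β (z 2) * deriv (deriv β) (z 2) - 2 * deriv β (z 2) ^ 2) := by
  have hW : 1 + a₁ ^ 2 + a₂ ^ 2 ≠ 0 := by positivity
  have hβ' : DifferentiableAt ℝ β (z 2) := hβ.differentiableAt (by simp)
  have hnormal : crossRows (planeRows a₁ a₂) ⬝ᵥ
      Matrix.single 2 2 (deriv (deriv β) (z 2)) *ᵥ crossRows (planeRows a₁ a₂) =
        deriv (deriv β) (z 2) := by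
    rw [single_mulVec_eq, dotProduct_smul, dotProduct_single_one, crossRows_planeRows]
    simp
  rw [bitensionPotential, hess_comp_apply hβ, hnormal, grad_dotProduct_crossRows_planeRows hβ',
    crossRows_planeRows_dotProduct_self, grad_comp_apply hβ', single_dotProduct, Pi.single_eq_same,
    trace_single_eq_same]
  field_simp
  ring

lemma forall_abs_normalTension_planeRows_eq_iff {U : Set (Fin 2 → ℝ)}
    (hβ : ∀ p ∈ U, DifferentiableAt ℝ β (planeHeight a₁ a₂ a₃ p)) (hf : ∀ p ∈ U, 0 < f p) :
    (∃ c > 0, ∀ p ∈ U,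
        |normalTension (fun z => β (z 2)) ![0, 0, a₃] (planeRows a₁ a₂) f p| = c) ↔
      ∃ c, 0 < c ∧ ∀ p ∈ U, deriv β (planeHeight a₁ a₂ a₃ p) ≠ 0 ∧
        f p = c * √(1 + a₁ ^ 2 + a₂ ^ 2) / |deriv β (planeHeight a₁ a₂ a₃ p)| := by
  have hW : 0 < √(1 + a₁ ^ 2 + a₂ ^ 2) := Real.sqrt_pos.mpr (by positivity)
  have hW₂ : 1 + a₁ ^ 2 + a₂ ^ 2 = √(1 + a₁ ^ 2 + a₂ ^ 2) ^ 2 :=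
    (Real.sq_sqrt (by positivity)).symm
  constructor
  · rintro ⟨c, hc, habs⟩
    refine ⟨c * √(1 + a₁ ^ 2 + a₂ ^ 2) / 2, by positivity, fun p hp => ?_⟩
    have hp' := habs p hp
    rw [abs_normalTension_planeRows (hβ p hp) (hf p hp), hW₂] at hp'
    have hβ₀ : deriv β (planeHeight a₁ a₂ a₃ p) ≠ 0 := by
      rintro h₀
      simp [h₀, hc.ne] at hp'
    refine ⟨hβ₀, ?_⟩
    rw [eq_div_iff (abs_ne_zero.mpr hβ₀), ← hp']
    field_simp
  · rintro ⟨c, hc, hfc⟩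
    refine ⟨2 * c / √(1 + a₁ ^ 2 + a₂ ^ 2), by positivity, fun p hp => ?_⟩
    obtain ⟨hβ₀, hfp⟩ := hfc p hp
    have habs : |deriv β (planeHeight a₁ a₂ a₃ p)| ≠ 0 := abs_ne_zero.mpr hβ₀
    rw [abs_normalTension_planeRows (hβ p hp) (hf p hp), hfp, hW₂,
      Real.sqrt_sq hW.le]
    field_simp

lemma contDiffAt_comp_apply_two {k : WithTop ℕ∞}
    (hβ : ContDiffAt ℝ k β (planeHeight a₁ a₂ a₃ p)) :
    ContDiffAt ℝ k (fun z : Fin 3 → ℝ => β (z 2))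
      (affinePatch ![0, 0, a₃] (planeRows a₁ a₂) p) :=
  ContDiffAt.comp (g := β) _ (by rwa [affinePatch_planeRows_apply_two]) (contDiffAt_apply ℝ ℝ 2 _)

theorem isProperBiharmonicOn_planeMap_iff {U : Set (Fin 2 → ℝ)} (hU : IsOpen U)
    (hUc : IsConnected U) (hβ : ∀ p ∈ U, ContDiffAt ℝ 3 β (planeHeight a₁ a₂ a₃ p))
    (hβU : ∀ p ∈ U, β (planeHeight a₁ a₂ a₃ p) ≠ 0) (hf : ContDiffOn ℝ 2 f U)
    (hfpos : ∀ p ∈ U, 0 < f p) :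
    IsProperBiharmonicOn (planeMetric β a₁ a₂ a₃ f) (confMetric β) (planeMap a₁ a₂ a₃) U ↔
      (∀ p ∈ U, β (planeHeight a₁ a₂ a₃ p) * deriv (deriv β) (planeHeight a₁ a₂ a₃ p) -
        2 * deriv β (planeHeight a₁ a₂ a₃ p) ^ 2 = 0) ∧
      ∃ c, 0 < c ∧ ∀ p ∈ U, deriv β (planeHeight a₁ a₂ a₃ p) ≠ 0 ∧
        f p = c * √(1 + a₁ ^ 2 + a₂ ^ 2) / |deriv β (planeHeight a₁ a₂ a₃ p)| := by
  have hiff := isProperBiharmonicOn_affinePatch_iff crossRows_planeRows_ne_zero hU hUc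
    (fun p hp => contDiffAt_comp_apply_two (hβ p hp))
    (fun p hp => by simpa only [affinePatch_planeRows_apply_two] using hβU p hp) hf
    fun p hp => (hfpos p hp).ne'
  rw [← planeMap_eq_affinePatch, forall_abs_normalTension_planeRows_eq_iff
    (fun p hp => (hβ p hp).differentiableAt (by simp)) hfpos] at hiff
  refine hiff.trans (and_congr_left fun _ => forall₂_congr fun p hp => ?_)
  have hW : 1 + (1 + a₁ ^ 2 + a₂ ^ 2)⁻¹ ≠ 0 := by positivity
  exact (bitensionPotential_planeRows (z := planeMap a₁ a₂ a₃ p) ((hβ p hp).of_le (by norm_num))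
    (hβU p hp)).congr_left.trans (mul_eq_zero_iff_left (div_ne_zero hW (hβU p hp)))

theorem hasMeanCurvatureOn_planeMap {U : Set (Fin 2 → ℝ)}
    (hβ : ∀ p ∈ U, DifferentiableAt ℝ β (planeHeight a₁ a₂ a₃ p))
    (hβU : ∀ p ∈ U, β (planeHeight a₁ a₂ a₃ p) ≠ 0) :
    HasMeanCurvatureOn (confMetric β) (planeMap a₁ a₂ a₃) (planeNormal β a₁ a₂ a₃)
      (fun p => deriv β (planeHeight a₁ a₂ a₃ p) / √(1 + a₁ ^ 2 + a₂ ^ 2)) U := by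
  have hξ : planeNormal β a₁ a₂ a₃ = fun p =>
      (β (affinePatch ![0, 0, a₃] (planeRows a₁ a₂) p 2) /
        √(crossRows (planeRows a₁ a₂) ⬝ᵥ crossRows (planeRows a₁ a₂))) •
          crossRows (planeRows a₁ a₂) := by
    funext p
    rw [affinePatch_planeRows_apply_two, crossRows_planeRows_dotProduct_self, crossRows_planeRows]
    rfl
  have hcurv :
      HasMeanCurvatureOn (confMetric β) (affinePatch ![0, 0, a₃] (planeRows a₁ a₂)) _ _ U :=
    hasMeanCurvatureOn_affinePatch (b := fun z => β (z 2)) crossRows_planeRows_ne_zero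
      (fun p hp => DifferentiableAt.comp (g := β) _
        (by simpa only [affinePatch_planeRows_apply_two] using hβ p hp)
        (differentiableAt_apply 2 _))
      (fun p hp => by simpa only [affinePatch_planeRows_apply_two] using hβU p hp)
  rw [planeMap_eq_affinePatch, hξ]
  refine ⟨hcurv.1, fun p hp => ?_⟩
  have hβp : DifferentiableAt ℝ β (affinePatch ![0, 0, a₃] (planeRows a₁ a₂) p 2) := by
    simpa only [affinePatch_planeRows_apply_two] using hβ p hp
  refine (hcurv.2 p hp).trans ?_
  simp only [grad_dotProduct_crossRows_planeRows hβp, crossRows_planeRows_dotProduct_self,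
    affinePatch_planeRows_apply_two]

end GraphPlane

end CoordGeom

end

open CoordGeom in
theorem mainTheorem10_general (a₁ a₂ a₃ : ℝ)
    (J : Set ℝ) (hJ : IsOpen J) (β : ℝ → ℝ) (hβ : ContDiffOn ℝ 3 β J) (hβpos : ∀ z ∈ J, 0 < β z)
    (U : Set (Fin 2 → ℝ)) (hU : IsOpen U) (hUc : IsConnected U)
    (hUJ : ∀ p ∈ U, planeHeight a₁ a₂ a₃ p ∈ J)
    (f : (Fin 2 → ℝ) → ℝ) (hf : ContDiffOn ℝ 2 f U) (hfpos : ∀ p ∈ U, 0 < f p) :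
    (IsProperBiharmonicOn (planeMetric β a₁ a₂ a₃ f) (confMetric β) (planeMap a₁ a₂ a₃) U ↔
      (¬ ∃ b : ℝ, ∀ z ∈ J, β z = b) ∧
      (∀ p ∈ U, β (planeHeight a₁ a₂ a₃ p) * deriv (deriv β) (planeHeight a₁ a₂ a₃ p)
          - 2 * deriv β (planeHeight a₁ a₂ a₃ p) ^ 2 = 0) ∧
      ∃ c : ℝ, 0 < c ∧ ∀ p ∈ U, deriv β (planeHeight a₁ a₂ a₃ p) ≠ 0 ∧
        f p = c * √(1 + a₁ ^ 2 + a₂ ^ 2) / |deriv β (planeHeight a₁ a₂ a₃ p)|) ∧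
    HasConformalFactorOn (planeMetric β a₁ a₂ a₃ f) (confMetric β) (planeMap a₁ a₂ a₃)
      (fun p => √(f p)) U ∧
    HasMeanCurvatureOn (confMetric β) (planeMap a₁ a₂ a₃) (planeNormal β a₁ a₂ a₃)
      (fun p => deriv β (planeHeight a₁ a₂ a₃ p) / √(1 + a₁ ^ 2 + a₂ ^ 2)) U := by
  have hheight (p) (hp : p ∈ U) : ContDiffAt ℝ 3 β (planeHeight a₁ a₂ a₃ p) :=
    hβ.contDiffAt (hJ.mem_nhds (hUJ p hp))
  have hβU (p) (hp : p ∈ U) : β (planeHeight a₁ a₂ a₃ p) ≠ 0 := (hβpos _ (hUJ p hp)).ne'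
  refine ⟨?_, hasConformalFactorOn_scaledPullback hfpos,
    hasMeanCurvatureOn_planeMap (fun p hp => (hheight p hp).differentiableAt (by simp)) hβU⟩
  rw [isProperBiharmonicOn_planeMap_iff hU hUc hheight hβU hf hfpos, iff_and_self]
  rintro ⟨-, c, -, hc⟩ ⟨b, hb⟩
  obtain ⟨p, hp⟩ := hUc.nonempty
  have hconst : β =ᶠ[nhds (planeHeight a₁ a₂ a₃ p)] fun _ => b :=
    Filter.eventually_of_mem (hJ.mem_nhds (hUJ p hp)) hb
  exact (hc p hp).1 (by rw [hconst.deriv_eq, deriv_const])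

theorem mainTheorem10 (a₁ a₂ a₃ : ℝ)
    (J : Set ℝ) (hJ : IsOpen J) (β : ℝ → ℝ) (hβ : ContDiffOn ℝ ∞ β J) (hβpos : ∀ z ∈ J, 0 < β z)
    (U : Set (Fin 2 → ℝ)) (hU : IsOpen U) (hUc : IsConnected U)
    (hUJ : ∀ p ∈ U, CoordGeom.planeHeight a₁ a₂ a₃ p ∈ J)
    (f : (Fin 2 → ℝ) → ℝ) (hf : ContDiffOn ℝ ∞ f U) (hfpos : ∀ p ∈ U, 0 < f p) :
    (CoordGeom.IsProperBiharmonicOn (CoordGeom.planeMetric β a₁ a₂ a₃ f)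
        (CoordGeom.confMetric β) (CoordGeom.planeMap a₁ a₂ a₃) U ↔
      (¬ ∃ b : ℝ, ∀ z ∈ J, β z = b) ∧
      (∀ p ∈ U, β (CoordGeom.planeHeight a₁ a₂ a₃ p)
            * deriv (deriv β) (CoordGeom.planeHeight a₁ a₂ a₃ p)
          - 2 * deriv β (CoordGeom.planeHeight a₁ a₂ a₃ p) ^ 2 = 0) ∧
      ∃ c : ℝ, 0 < c ∧ ∀ p ∈ U, deriv β (CoordGeom.planeHeight a₁ a₂ a₃ p) ≠ 0 ∧
        f p = c * √(1 + a₁ ^ 2 + a₂ ^ 2) / |deriv β (CoordGeom.planeHeight a₁ a₂ a₃ p)|) ∧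
    CoordGeom.HasConformalFactorOn (CoordGeom.planeMetric β a₁ a₂ a₃ f)
      (CoordGeom.confMetric β) (CoordGeom.planeMap a₁ a₂ a₃) (fun p => √(f p)) U ∧
    CoordGeom.HasMeanCurvatureOn (CoordGeom.confMetric β) (CoordGeom.planeMap a₁ a₂ a₃)
      (CoordGeom.planeNormal β a₁ a₂ a₃)
      (fun p => deriv β (CoordGeom.planeHeight a₁ a₂ a₃ p) / √(1 + a₁ ^ 2 + a₂ ^ 2)) U := by
  exact mainTheorem10_general a₁ a₂ a₃ J hJ β (hβ.of_le ENat.LEInfty.out) hβpos U hU hUc hUJ f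
    (hf.of_le ENat.LEInfty.out) hfpos
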